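/- For a function on $[0,1]$, derivatives at the endpoints are one-sided. Let $f_0:[0,1]\to[0,\infty)$ be a probability density (with respect to Lebesgue measure $\lambda$) such that: 1. $f_0$ is Hölder $3$-smooth on $[0,1]$, i.e. $f_0$ is twice differentiable and $f_0''$ is Lipschitz; $f_0'''$ (wherever it exists) is bounded; and $|f_0''|$ is bounded away from $0$ on some nondegenerate interval $I\subset(0,1)$. 2. (BC1) $f_0'(x)=a_0x^p+o(x^p)$ as $x\downarrow 0$ and (BC2) $f_0'(x)=b_0(1-x)^q+o((1-x)^q)$ as $x\uparrow 1$, for some $a_0,b_0\in\mathbb R$ and some $1\le p,q<\infty$. 3. $1/f_0\in L^1(\lambda)$. For $k\ge 1$ let $A_{1,k}=[0,1/k]$, $A_{j,k}=((j-1)/k,\,j/k]$ ($2\le j\le k$), let $c_{j,k}=(j-1/2)/k$, and let $A_{j,k}^-$, $A_{j,k}^+$ be the left and right halves of $A_{j,k}$. For $w=(w_1,\dots,w_k)$ in the simplex $\Delta^{k-1}$ let $$p_{k,w}(x)=k w_1\mathbf 1_{A_{1,k}^-}(x)+\sum_{j=1}^{k-1}\bigl[k(c_{j+1,k}-x)w_j+k(x-c_{j,k})w_{j+1}\bigr]k\,\mathbf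 1_{A_{j,k}^+\cup A_{j+1,k}^-}(x)+k w_k\mathbf 1_{A_{k,k}^+}(x).$$ Let $\Pi$ be a polygonally smoothed prior: a number $k\in\{1,2,\dots\}$ is drawn from a probability mass function $\rho$; given $k$, the weights $w$ are drawn from the Dirichlet distribution with parameters $\alpha(A_{1,k}),\dots,\alpha(A_{k,k})$ (that is, $w_j=P(A_{j,k})$ for a Dirichlet process $P$ with base measure $\alpha$); the random density is $f_P=p_{k,w}$. Assume that $B_1e^{-\beta_1k\log k}\le\rho(k)\le B_2e^{-\beta_2k\log k}$ for all $k\ge1$, with constants $B_1,B_2,\beta_1,\beta_2>0$, and that the finite measure $\alpha$ has a continuous and positive density on $[0,1]$. Let $X_1,\dots,X_n$ be i.i.d. from the law $P_0$ with density $f_0$, let $P_0^n$ be their joint law, and let $$\Pi(B\mid X^{(n)})=\frac{\int_B\prod_{i=1}^n (f_P/f_0)(X_i)\,\Pi(dP)}{\int\prod_{i=1}^n (f_P/f_0)(X_i)\,\Pi(dP)}$$ be the posterior distribution. Then $$\Pi\bigl(P:\ \|f_P-f_0\|_{L^1([0,1])}\le n^{-3/7}\,\big|\,X^{(n)}\bigr)\longrightarrow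 0\quad\text{in }P_0^n\text{-probability, as }n\to\infty.$$ -/

import Mathlib

open MeasureTheory ProbabilityTheory Set Filter Topology Asymptotics

namespace RandomPolygon

noncomputable section

/-- The (finite) measure on `[0,1]`, seen as a measure on `ℝ`, with density `g` with respect to
Lebesgue measure. -/
def measureOfDensity (g : ℝ → ℝ) : Measure ℝ :=
  (volume.restrict (Icc (0 : ℝ) 1)).withDensity (fun x => ENNReal.ofReal (g x))

/-- The `L¹` distance on `[0,1]`. -/
def l1Dist (f g : ℝ → ℝ) : ℝ := ∫ x in Icc (0 : ℝ) 1, |f x - g x|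

/-- The `i`-th derivative of `f` on `[0,1]` (one-sided at the endpoints). -/
def der (i : ℕ) (f : ℝ → ℝ) : ℝ → ℝ := iteratedDerivWithin i f (Icc 0 1)

/-- Hölder `β`-smoothness on `[0,1]`, for `β > 0`: with `l` the largest natural number strictly
smaller than `β`, that is `l = ⌈β⌉ - 1`, the function is `l` times differentiable on `[0,1]` and
its `l`-th derivative is Hölder continuous with exponent `β - l`. -/
def IsHolderSmooth (β : ℝ) (f : ℝ → ℝ) : Prop :=
  (∀ i < ⌈β⌉₊ - 1, DifferentiableOn ℝ (der i f) (Icc 0 1)) ∧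
    ∃ L > 0, ∀ x ∈ Icc (0 : ℝ) 1, ∀ y ∈ Icc (0 : ℝ) 1,
      |der (⌈β⌉₊ - 1) f x - der (⌈β⌉₊ - 1) f y| ≤ L * |x - y| ^ (β - ((⌈β⌉₊ - 1 : ℕ) : ℝ))

/-- The class of densities `f` on `[0,1]` with `f''` bounded away from `0` on a (nondegenerate)
interval contained in `(0,1)` and with `f'''` bounded.  (`der 3 f x` is `0` at the points where
`f'''` does not exist, so only the existing values of `f'''` are constrained.) -/
structure MemF3 (f : ℝ → ℝ) : Prop where
  nonneg : ∀ x ∈ Icc (0 : ℝ) 1, 0 ≤ f x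
  norm_one : ∫ x in Icc (0 : ℝ) 1, |f x| = 1
  second_away : ∃ u v c : ℝ, 0 ≤ u ∧ u < v ∧ v ≤ 1 ∧ 0 < c ∧ ∀ x ∈ Ioo u v, c ≤ |der 2 f x|
  third_bdd : ∃ M : ℝ, ∀ x ∈ Icc (0 : ℝ) 1, |der 3 f x| ≤ M

/-- Boundary condition at `0`: `f'(x) = a x ^ p + o(x ^ p)` as `x ↓ 0`, with a real `a` and a
finite exponent `p ≥ 1`. -/
def BC1 (f : ℝ → ℝ) : Prop :=
  ∃ a p : ℝ, 1 ≤ p ∧ (fun x => der 1 f x - a * x ^ p) =o[𝓝[>] 0] (fun x : ℝ => x ^ p)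

/-- Boundary condition at `1`: `f'(x) = b (1 - x) ^ q + o((1 - x) ^ q)` as `x ↑ 1`, with a real `b`
and a finite exponent `q ≥ 1`. -/
def BC2 (f : ℝ → ℝ) : Prop :=
  ∃ b q : ℝ, 1 ≤ q ∧
    (fun x => der 1 f x - b * (1 - x) ^ q) =o[𝓝[<] 1] (fun x : ℝ => (1 - x) ^ q)

/-! ### Polygons with `k = m + 1` bins; bins are numbered from `0` -/

/-- The bins of the partition of `[0,1]` into `k = m + 1` intervals of equal length: the first one
is `[0, 1/k]`, the other ones are `(j/k, (j+1)/k]`. -/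
def bin (m : ℕ) (j : Fin (m + 1)) : Set ℝ :=
  if j = 0 then Icc 0 (1 / ((m : ℝ) + 1))
  else Ioc ((j : ℝ) / ((m : ℝ) + 1)) (((j : ℝ) + 1) / ((m : ℝ) + 1))

/-- The midpoint of a bin. -/
def mid (m : ℕ) (j : Fin (m + 1)) : ℝ := ((j : ℝ) + 1 / 2) / ((m : ℝ) + 1)

/-- The left half of a bin. -/
def binLeft (m : ℕ) (j : Fin (m + 1)) : Set ℝ := bin m j ∩ Iic (mid m j)

/-- The right half of a bin. -/
def binRight (m : ℕ) (j : Fin (m + 1)) : Set ℝ := bin m j ∩ Ioi (mid m j)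

/-- The `k`-regular polygon, `k = m + 1`, with weights `w`: it joins by straight lines the heights
`k * w j` at the midpoints of the bins, and is constant on the first and the last half bin. -/
def polygon (m : ℕ) (w : Fin (m + 1) → ℝ) (x : ℝ) : ℝ :=
  (binLeft m 0).indicator (fun _ => w 0 * ((m : ℝ) + 1)) x
  + ∑ j : Fin m, (binRight m j.castSucc ∪ binLeft m j.succ).indicator
      (fun x => (((m : ℝ) + 1) * (mid m j.succ - x) * w j.castSucc
        + ((m : ℝ) + 1) * (x - mid m j.castSucc) * w j.succ) * ((m : ℝ) + 1)) x
  + (binRight m (Fin.last m)).indicator (fun _ => w (Fin.last m) * ((m : ℝ) + 1)) x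

/-! ### The prior and the posterior -/

/-- The Dirichlet distribution with parameters `a i > 0`: the law of `(G i / ∑ j, G j)` for
independent `G i` with Gamma distributions of shape `a i` and rate `1`. -/
def dirichlet {ι : Type*} [Fintype ι] (a : ι → ℝ) : Measure (ι → ℝ) :=
  (Measure.pi (fun i => gammaMeasure (a i) 1)).map (fun g i => g i / ∑ j, g j)

/-- The parameters of a random polygon: the number `k = m + 1` of bins, together with the weights
of the bins. -/
abbrev Param : Type := Σ m : ℕ, (Fin (m + 1) → ℝ)

/-- The density which belongs to a parameter. -/
def density (θ : Param) : ℝ → ℝ := polygon θ.1 θ.2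

/-- The polygonally smoothed prior: the number `k` of bins has probability `ρ k` (`k ≥ 1`), and
given `k` the vector `(P(A₁), …, P(A_k))` of the weights of the bins `A₁, …, A_k`, for `P` a
Dirichlet process with base measure `α`, has the Dirichlet distribution with parameters
`α(A₁), …, α(A_k)`. -/
def polygonPrior (ρ : ℕ → ℝ) (α : Measure ℝ) : Measure Param :=
  Measure.sum fun m : ℕ =>
    ENNReal.ofReal (ρ (m + 1)) • (dirichlet fun j => (α (bin m j)).toReal).map (Sigma.mk m)

/-- The posterior probability of a set `B` of parameters given the observations `X`, by Bayes'
formula. -/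
def posterior (Pr : Measure Param) (f₀ : ℝ → ℝ) {n : ℕ} (X : Fin n → ℝ) (B : Set Param) :
    ENNReal :=
  (∫⁻ θ in B, ∏ i, ENNReal.ofReal (density θ (X i) / f₀ (X i)) ∂Pr) /
    ∫⁻ θ, ∏ i, ENNReal.ofReal (density θ (X i) / f₀ (X i)) ∂Pr

end

end RandomPolygon

/-! The radius `n^(-3/7)` is too small for the numbers of bins that the posterior can afford. On an
interval where `f₀''` has constant sign and size at least `c`, a polygon is affine on each half bin,
so no polygon with `k` bins comes closer to `f₀` in `L¹` than `C k⁻²` (`exists_l1Dist_polygon_ge`).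
The event therefore forces `k ≥ √C n^(3/14)`, which has prior probability at most `exp(-const ·
n^(3/14))` up to a factor (`exists_tail_bound`). Likelihood ratios have mean at most one, so the
numerator of Bayes' formula is no larger than this in mean.

The denominator is larger, because far fewer bins already fit well. The boundary conditions enter
only through `f₀'(0) = f₀'(1) = 0`. Together with integrability of `1/f₀` this keeps `f₀` away from
zero (`exists_pos_lower_bound`), and it makes the constant end pieces of a polygon harmless, so that
weights near the bin integrals of `f₀` give a uniform error of order `k⁻²`
(`abs_polygon_normalize_sub_le`). For `k` of order `n^(1/5)`, `n` times the resulting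
`χ²`-divergence is `O(k)`, while such weights have Dirichlet probability at least `exp(-O(k log k))`
(`le_pi_gammaMeasure_Icc`).

The arithmetic-geometric inequality and Markov's inequality turn this into an evidence bound
`exp(-O(k log k))` with high probability, and hence into a nonasymptotic bound for the posterior
(`measure_posterior_gt_le`). The limit follows because `1/5 < 3/14`, so that `n^(1/5) log n =
o(n^(3/14))` (`tendsto_exponent`). -/

namespace RandomPolygon

/-! ### Piecewise affine form of polygons -/

lemma binLeft_zero (m : ℕ) : binLeft m 0 = Icc 0 (mid m 0) := by
  have hk : (0 : ℝ) < (m : ℝ) + 1 := by positivity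
  have : mid m 0 ≤ 1 / ((m : ℝ) + 1) := by
    simp only [mid]
    gcongr
    norm_num
  ext x
  simp only [binLeft, bin, if_true, mem_inter_iff, mem_Icc, mem_Iic]
  constructor
  · rintro ⟨⟨h1, _⟩, h2⟩
    exact ⟨h1, h2⟩
  · rintro ⟨h1, h2⟩
    exact ⟨⟨h1, h2.trans this⟩, h2⟩

lemma mid_pos (m : ℕ) (j : Fin (m + 1)) : 0 < mid m j := by
  unfold mid
  positivity

lemma binRight_eq (m : ℕ) (j : Fin (m + 1)) :
    binRight m j = Ioc (mid m j) (((j : ℝ) + 1) / ((m : ℝ) + 1)) := by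
  have hk : (0 : ℝ) < (m : ℝ) + 1 := by positivity
  have hj : (j : ℝ) / ((m : ℝ) + 1) ≤ mid m j := by
    simp only [mid]
    gcongr
    norm_num
  have hp := mid_pos m j
  ext x
  by_cases h : j = 0
  · subst h
    simp only [binRight, bin, if_true, mem_inter_iff, mem_Icc, mem_Ioi, mem_Ioc, Fin.val_zero,
      Nat.cast_zero, zero_add]
    constructor
    · rintro ⟨⟨_, h1⟩, h2⟩
      exact ⟨h2, h1⟩
    · rintro ⟨h1, h2⟩
      exact ⟨⟨(hp.trans h1).le, h2⟩, h1⟩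
  · simp only [binRight, bin, if_neg h, mem_inter_iff, mem_Ioc, mem_Ioi]
    constructor
    · rintro ⟨⟨_, h1⟩, h2⟩
      exact ⟨h2, h1⟩
    · rintro ⟨h1, h2⟩
      exact ⟨⟨hj.trans_lt h1, h2⟩, h1⟩

lemma binLeft_eq (m : ℕ) (j : Fin (m + 1)) (h : j ≠ 0) :
    binLeft m j = Ioc ((j : ℝ) / ((m : ℝ) + 1)) (mid m j) := by
  have hk : (0 : ℝ) < (m : ℝ) + 1 := by positivity
  have hj : mid m j ≤ ((j : ℝ) + 1) / ((m : ℝ) + 1) := by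
    simp only [mid]
    gcongr
    norm_num
  ext x
  simp only [binLeft, bin, if_neg h, mem_inter_iff, mem_Ioc, mem_Iic]
  constructor
  · rintro ⟨⟨h1, _⟩, h2⟩
    exact ⟨h1, h2⟩
  · rintro ⟨h1, h2⟩
    exact ⟨⟨h1, h2.trans hj⟩, h2⟩

/-- The two half bins meet at the common endpoint of neighbouring bins. Hence the breakpoints of a
polygon are the midpoints, and the bins themselves can be forgotten. -/
lemma binRight_union_binLeft (m : ℕ) (j : Fin m) :
    binRight m j.castSucc ∪ binLeft m j.succ = Ioc (mid m j.castSucc) (mid m j.succ) := by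
  have hk : (0 : ℝ) < (m : ℝ) + 1 := by positivity
  rw [binRight_eq, binLeft_eq m j.succ (Fin.succ_ne_zero j)]
  have : (((j.castSucc : Fin (m + 1)) : ℝ) + 1) / ((m : ℝ) + 1)
      = ((j.succ : Fin (m + 1)) : ℝ) / ((m : ℝ) + 1) := by simp
  rw [this]
  apply Ioc_union_Ioc_eq_Ioc
  · simp only [mid, Fin.val_castSucc, Fin.val_succ, Nat.cast_add, Nat.cast_one]
    gcongr
    norm_num
  · simp only [mid]
    gcongr
    norm_num

lemma binRight_last (m : ℕ) : binRight m (Fin.last m) = Ioc (mid m (Fin.last m)) 1 := by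
  rw [binRight_eq, Fin.val_last, div_self (by positivity)]

lemma mid_mono (m : ℕ) : Monotone (mid m) := by
  intro i j h
  have : (i : ℝ) ≤ (j : ℝ) := by exact_mod_cast h
  unfold mid
  gcongr

lemma polygon_eq (m : ℕ) (w : Fin (m + 1) → ℝ) (x : ℝ) :
    polygon m w x = (Icc 0 (mid m 0)).indicator (fun _ => w 0 * ((m : ℝ) + 1)) x
      + ∑ j : Fin m, (Ioc (mid m j.castSucc) (mid m j.succ)).indicator
        (fun x => (((m : ℝ) + 1) * (mid m j.succ - x) * w j.castSucc
          + ((m : ℝ) + 1) * (x - mid m j.castSucc) * w j.succ) * ((m : ℝ) + 1)) x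
      + (Ioc (mid m (Fin.last m)) 1).indicator (fun _ => w (Fin.last m) * ((m : ℝ) + 1)) x := by
  simp only [polygon, binLeft_zero, binRight_last, binRight_union_binLeft]

lemma polygon_of_le_mid_zero {m : ℕ} (w : Fin (m + 1) → ℝ) {x : ℝ} (h0 : 0 ≤ x)
    (h : x ≤ mid m 0) : polygon m w x = w 0 * ((m : ℝ) + 1) := by
  rw [polygon_eq, indicator_of_mem (show x ∈ Icc 0 (mid m 0) from ⟨h0, h⟩),
    Finset.sum_eq_zero, indicator_of_notMem]
  · ring
  · rintro ⟨h1, _⟩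
    exact absurd (h.trans (mid_mono m (Fin.zero_le _))) (not_le.2 h1)
  · intro j _
    rw [indicator_of_notMem]
    rintro ⟨h1, _⟩
    exact absurd (h.trans (mid_mono m (Fin.zero_le _))) (not_le.2 h1)

lemma polygon_of_mid_last_lt {m : ℕ} (w : Fin (m + 1) → ℝ) {x : ℝ} (h : mid m (Fin.last m) < x)
    (h1 : x ≤ 1) : polygon m w x = w (Fin.last m) * ((m : ℝ) + 1) := by
  rw [polygon_eq, indicator_of_mem (show x ∈ Ioc (mid m (Fin.last m)) 1 from ⟨h, h1⟩),
    Finset.sum_eq_zero, indicator_of_notMem]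
  · ring
  · rintro ⟨_, h1⟩
    exact absurd (h1.trans (mid_mono m (Fin.zero_le _))) (not_le.2 h)
  · intro j _
    rw [indicator_of_notMem]
    rintro ⟨_, h1⟩
    exact absurd (h1.trans (mid_mono m (Fin.le_last _))) (not_le.2 h)

lemma polygon_of_mem_Ioc {m : ℕ} (w : Fin (m + 1) → ℝ) (j : Fin m) {x : ℝ}
    (h : x ∈ Ioc (mid m j.castSucc) (mid m j.succ)) :
    polygon m w x = (((m : ℝ) + 1) * (mid m j.succ - x) * w j.castSucc
      + ((m : ℝ) + 1) * (x - mid m j.castSucc) * w j.succ) * ((m : ℝ) + 1) := by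
  rw [polygon_eq, indicator_of_notMem, Finset.sum_eq_single j, indicator_of_mem h,
    indicator_of_notMem]
  · ring
  · rintro ⟨h1, _⟩
    exact absurd (h.2.trans (mid_mono m (Fin.le_last _))) (not_le.2 h1)
  · intro i _ hij
    rw [indicator_of_notMem]
    rintro ⟨h1, h2⟩
    rcases lt_or_gt_of_ne hij with hlt | hlt
    · have : i.succ ≤ j.castSucc := by
        rw [Fin.le_def]; simp only [Fin.val_succ, Fin.val_castSucc]; omega
      exact absurd (h2.trans (mid_mono m this)) (not_le.2 h.1)
    · have : j.succ ≤ i.castSucc := by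
        rw [Fin.le_def]; simp only [Fin.val_succ, Fin.val_castSucc]; omega
      exact absurd (h.2.trans (mid_mono m this)) (not_le.2 h1)
  · simp
  · rintro ⟨_, h1⟩
    exact absurd (h1.trans (mid_mono m (Fin.zero_le _))) (not_le.2 h.1)

lemma unitInterval_cases (m : ℕ) (x : ℝ) :
    x ≤ mid m 0 ∨ (∃ j : Fin m, x ∈ Ioc (mid m j.castSucc) (mid m j.succ))
      ∨ mid m (Fin.last m) < x := by
  by_cases h0 : x ≤ mid m 0
  · exact Or.inl h0
  by_cases h1 : mid m (Fin.last m) < x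
  · exact Or.inr (Or.inr h1)
  refine Or.inr (Or.inl ?_)
  have hk : (0 : ℝ) < (m : ℝ) + 1 := by positivity
  push Not at h0 h1
  simp only [mid, Fin.val_zero, Nat.cast_zero, zero_add, Fin.val_last] at h0 h1
  rw [div_lt_iff₀ hk] at h0
  rw [le_div_iff₀ hk] at h1
  -- The index sought satisfies `j + 1/2 < x (m + 1) ≤ j + 3/2`, that is, `j + 1 = ⌈y⌉₊`.
  set y := x * ((m : ℝ) + 1) - 1 / 2 with hy
  have hN1 : 0 < ⌈y⌉₊ := Nat.ceil_pos.2 (by linarith)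
  have hN2 : ⌈y⌉₊ ≤ m := Nat.ceil_le.2 (by linarith)
  have hN3 : y ≤ ⌈y⌉₊ := Nat.le_ceil y
  have hN4 : (⌈y⌉₊ : ℝ) < y + 1 := Nat.ceil_lt_add_one (by linarith)
  obtain ⟨N, hN⟩ : ∃ N, ⌈y⌉₊ = N + 1 := ⟨⌈y⌉₊ - 1, by omega⟩
  rw [hN] at hN2 hN3 hN4
  push_cast at hN3 hN4
  refine ⟨⟨N, by omega⟩, ?_, ?_⟩
  · simp only [mid, Fin.val_castSucc]
    rw [div_lt_iff₀ hk]
    linarith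
  · simp only [mid, Fin.val_succ]
    rw [le_div_iff₀ hk]
    push_cast
    linarith

/-- A polygon is affine on every half bin. -/
lemma exists_affine_polygon {m : ℕ} (w : Fin (m + 1) → ℝ) {q : ℕ} (hq : q < 2 * (m + 1)) :
    ∃ A B : ℝ, ∀ x ∈ Ioo ((q : ℝ) / (2 * ((m : ℝ) + 1))) (((q : ℝ) + 1) / (2 * ((m : ℝ) + 1))),
      polygon m w x = A + B * x := by
  have hk : (0 : ℝ) < (m : ℝ) + 1 := by positivity
  have hk2 : (0 : ℝ) < 2 * ((m : ℝ) + 1) := by positivity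
  rcases Nat.eq_zero_or_pos q with rfl | hq0
  · refine ⟨w 0 * ((m : ℝ) + 1), 0, fun x hx => ?_⟩
    simp only [Nat.cast_zero, zero_div, zero_add] at hx
    rw [polygon_of_le_mid_zero w hx.1.le]
    · ring
    · refine hx.2.le.trans (le_of_eq ?_)
      simp [mid]
      ring
  by_cases hq1 : q = 2 * m + 1
  · refine ⟨w (Fin.last m) * ((m : ℝ) + 1), 0, fun x hx => ?_⟩
    subst hq1
    rw [polygon_of_mid_last_lt w]
    · ring
    · refine lt_of_le_of_lt (le_of_eq ?_) hx.1
      simp only [mid, Fin.val_last]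
      push_cast
      field_simp
    · refine hx.2.le.trans (le_of_eq ?_)
      push_cast
      field_simp
      ring
  -- Half bins number `2j + 1` and `2j + 2` make up the segment between the midpoints of bins `j`
  -- and `j + 1`; numbers `0` and `2m + 1` were the flat ends.
  obtain ⟨j, hj⟩ : ∃ j, q = 2 * j + 1 ∨ q = 2 * j + 2 := ⟨(q - 1) / 2, by omega⟩
  have hjm : j < m := by omega
  refine ⟨(((m : ℝ) + 1) * mid m (Fin.succ ⟨j, hjm⟩) * w (Fin.castSucc ⟨j, hjm⟩)
      - ((m : ℝ) + 1) * mid m (Fin.castSucc ⟨j, hjm⟩) * w (Fin.succ ⟨j, hjm⟩)) * ((m : ℝ) + 1),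
    ((m : ℝ) + 1) * (w (Fin.succ ⟨j, hjm⟩) - w (Fin.castSucc ⟨j, hjm⟩)) * ((m : ℝ) + 1),
    fun x hx => ?_⟩
  have hq2 : 2 * (j : ℝ) + 1 ≤ q ∧ (q : ℝ) ≤ 2 * j + 2 := by
    rcases hj with rfl | rfl <;> push_cast <;> constructor <;> linarith
  rw [mem_Ioo, div_lt_iff₀ hk2, lt_div_iff₀ hk2] at hx
  rw [polygon_of_mem_Ioc w ⟨j, hjm⟩]
  · ring
  · constructor
    · simp only [mid, Fin.val_castSucc]
      rw [div_lt_iff₀ hk]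
      linarith
    · simp only [mid, Fin.val_succ]
      rw [le_div_iff₀ hk]
      push_cast
      linarith

/-! ### Measurability, integrability and total mass of polygons -/

lemma measurable_polygon (m : ℕ) :
    Measurable (fun p : (Fin (m + 1) → ℝ) × ℝ => polygon m p.1 p.2) := by
  simp only [polygon_eq, indicator_apply]
  refine Measurable.add (Measurable.add ?_ (Finset.measurable_fun_sum _ fun j _ => ?_)) ?_
  · exact Measurable.ite (measurable_snd measurableSet_Icc) (by fun_prop) measurable_const
  · exact Measurable.ite (measurable_snd measurableSet_Ioc) (by fun_prop) measurable_const
  · exact Measurable.ite (measurable_snd measurableSet_Ioc) (by fun_prop) measurable_const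

lemma integrable_affine_indicator (a b A B : ℝ) :
    Integrable ((Ioc a b).indicator fun x => A + B * x) := by
  rw [integrable_indicator_iff measurableSet_Ioc]
  exact ((by fun_prop : Continuous fun x => A + B * x).continuousOn.integrableOn_Icc).mono_set
    Ioc_subset_Icc_self

lemma polygon_nonneg {m : ℕ} {w : Fin (m + 1) → ℝ} (hw : ∀ i, 0 ≤ w i) (x : ℝ) :
    0 ≤ polygon m w x := by
  rw [polygon_eq]
  have hk : (0 : ℝ) ≤ (m : ℝ) + 1 := by positivity
  refine add_nonneg (add_nonneg (indicator_nonneg (fun _ _ => mul_nonneg (hw _) hk) _)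
    (Finset.sum_nonneg fun j _ => indicator_nonneg (fun x hx => ?_) _))
    (indicator_nonneg (fun _ _ => mul_nonneg (hw _) hk) _)
  exact mul_nonneg (add_nonneg (mul_nonneg (mul_nonneg hk (sub_nonneg.2 hx.2)) (hw _))
    (mul_nonneg (mul_nonneg hk (sub_nonneg.2 hx.1.le)) (hw _))) hk

/-- Dropping the null set `{0}` puts all pieces into one shape, an affine function on a half-open
interval, so that a single integral formula serves them all. -/
lemma polygon_eq_affine (m : ℕ) (w : Fin (m + 1) → ℝ) :
    polygon m w =ᵐ[volume] fun x =>
      (Ioc 0 (mid m 0)).indicator (fun x => w 0 * ((m : ℝ) + 1) + 0 * x) x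
      + ∑ j : Fin m, (Ioc (mid m j.castSucc) (mid m j.succ)).indicator
        (fun x => ((mid m j.succ * w j.castSucc - mid m j.castSucc * w j.succ) * ((m : ℝ) + 1) ^ 2)
          + ((w j.succ - w j.castSucc) * ((m : ℝ) + 1) ^ 2) * x) x
      + (Ioc (mid m (Fin.last m)) 1).indicator
        (fun x => w (Fin.last m) * ((m : ℝ) + 1) + 0 * x) x := by
  filter_upwards [compl_mem_ae_iff.2 (measure_singleton (0 : ℝ))] with x hx
  rw [polygon_eq]
  congr 1
  · congr 1
    · by_cases h : x ∈ Ioc 0 (mid m 0)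
      · rw [indicator_of_mem h, indicator_of_mem (Ioc_subset_Icc_self h)]
        ring
      · rw [indicator_of_notMem h, indicator_of_notMem]
        rintro ⟨h1, h2⟩
        exact h ⟨lt_of_le_of_ne h1 (Ne.symm hx), h2⟩
    · refine Finset.sum_congr rfl fun j _ => ?_
      congr 1
      ext y
      ring
  · congr 1
    ext y
    ring

lemma integrable_polygon (m : ℕ) (w : Fin (m + 1) → ℝ) : Integrable (polygon m w) := by
  refine Integrable.congr ?_ (polygon_eq_affine m w).symm
  exact ((integrable_affine_indicator _ _ _ _).add (integrable_finsetSum _ fun j _ =>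
    integrable_affine_indicator _ _ _ _)).add (integrable_affine_indicator _ _ _ _)

lemma integral_affine_indicator {a b : ℝ} (hab : a ≤ b) (A B : ℝ) :
    ∫ x, (Ioc a b).indicator (fun x => A + B * x) x
      = A * (b - a) + B * ((b ^ 2 - a ^ 2) / 2) := by
  rw [integral_indicator measurableSet_Ioc, ← intervalIntegral.integral_of_le hab,
    intervalIntegral.integral_add (by simp) (by
      exact (Continuous.intervalIntegrable (by fun_prop) _ _)),
    intervalIntegral.integral_const, intervalIntegral.integral_const_mul, integral_id]
  simp only [smul_eq_mul]
  ring

lemma mid_last_le_one (m : ℕ) : mid m (Fin.last m) ≤ 1 := by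
  unfold mid
  rw [div_le_one (by positivity), Fin.val_last]
  linarith

/-- The trapezoid between neighbouring midpoints has area `(w j + w (j + 1)) / 2`; the flat half
bins at the ends supply the missing halves of the first and last weights. -/
lemma integral_polygon (m : ℕ) (w : Fin (m + 1) → ℝ) : ∫ x, polygon m w x = ∑ i, w i := by
  have hk : (0 : ℝ) < (m : ℝ) + 1 := by positivity
  rw [integral_congr_ae (polygon_eq_affine m w), integral_add, integral_add, integral_finsetSum,
    integral_affine_indicator (mid_pos m 0).le, integral_affine_indicator (mid_last_le_one m)]
  · have hj : ∀ j : Fin m, ∫ x, (Ioc (mid m j.castSucc) (mid m j.succ)).indicator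
        (fun x => ((mid m j.succ * w j.castSucc - mid m j.castSucc * w j.succ) * ((m : ℝ) + 1) ^ 2)
          + ((w j.succ - w j.castSucc) * ((m : ℝ) + 1) ^ 2) * x) x
        = (w j.castSucc + w j.succ) / 2 := by
      intro j
      rw [integral_affine_indicator (mid_mono m (Fin.castSucc_le_succ j))]
      simp only [mid, Fin.val_castSucc, Fin.val_succ]
      push_cast
      field_simp
      ring
    simp only [hj]
    have h1 := Fin.sum_univ_castSucc w
    have h2 := Fin.sum_univ_succ w
    have h3 : ∑ j : Fin m, (w j.castSucc + w j.succ) / 2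
        = (∑ j : Fin m, w j.castSucc + ∑ j : Fin m, w j.succ) / 2 := by
      rw [← Finset.sum_add_distrib, Finset.sum_div]
    rw [h3]
    have e0 : w 0 * ((m : ℝ) + 1) * (mid m 0 - 0) = w 0 / 2 := by
      simp only [mid, Fin.val_zero]
      push_cast
      field_simp
      ring
    have e1 : w (Fin.last m) * ((m : ℝ) + 1) * (1 - mid m (Fin.last m)) = w (Fin.last m) / 2 := by
      simp only [mid, Fin.val_last]
      field_simp
      ring
    rw [e0, e1]
    linarith
  · exact fun j _ => integrable_affine_indicator _ _ _ _
  · exact integrable_affine_indicator _ _ _ _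
  · exact integrable_finsetSum _ fun j _ => integrable_affine_indicator _ _ _ _
  · exact (integrable_affine_indicator _ _ _ _).add (integrable_finsetSum _ fun j _ =>
      integrable_affine_indicator _ _ _ _)
  · exact integrable_affine_indicator _ _ _ _

lemma setIntegral_polygon (m : ℕ) (w : Fin (m + 1) → ℝ) :
    ∫ x in Icc (0 : ℝ) 1, polygon m w x = ∑ i, w i := by
  rw [← integral_polygon, setIntegral_eq_integral_of_forall_compl_eq_zero]
  intro x hx
  rw [polygon_eq, indicator_of_notMem, Finset.sum_eq_zero, indicator_of_notMem]
  · simp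
  · rintro ⟨h1, h2⟩
    exact hx ⟨(mid_pos m _).le.trans h1.le, h2⟩
  · intro j _
    rw [indicator_of_notMem]
    rintro ⟨h1, h2⟩
    exact hx ⟨(mid_pos m _).le.trans h1.le,
      h2.trans ((mid_mono m (Fin.le_last _)).trans (mid_last_le_one m))⟩
  · rintro ⟨h1, h2⟩
    exact hx ⟨h1, h2.trans ((mid_mono m (Fin.le_last _)).trans (mid_last_le_one m))⟩

/-! ### Consequences of smoothness and of the boundary conditions -/

lemma IsHolderSmooth.three {f : ℝ → ℝ} (h : IsHolderSmooth 3 f) :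
    (∀ x ∈ Icc (0 : ℝ) 1, HasDerivWithinAt f (der 1 f x) (Icc 0 1) x) ∧
    (∀ x ∈ Icc (0 : ℝ) 1, HasDerivWithinAt (der 1 f) (der 2 f x) (Icc 0 1) x) ∧
    ∃ L > 0, ∀ x ∈ Icc (0 : ℝ) 1, ∀ y ∈ Icc (0 : ℝ) 1,
      |der 2 f x - der 2 f y| ≤ L * |x - y| := by
  have h3 : ⌈(3 : ℝ)⌉₊ - 1 = 2 := by
    rw [show (3 : ℝ) = ((3 : ℕ) : ℝ) by norm_num, Nat.ceil_natCast]
  obtain ⟨h1, L, hL, h2⟩ := h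
  rw [h3] at h1 h2
  refine ⟨fun x hx => ?_, fun x hx => ?_, L, hL, fun x hx y hy => ?_⟩
  · have := (h1 0 (by norm_num) x hx).hasDerivWithinAt
    simp only [der, iteratedDerivWithin_zero] at this ⊢
    rwa [iteratedDerivWithin_one]
  · have := (h1 1 (by norm_num) x hx).hasDerivWithinAt
    simp only [der] at this ⊢
    rwa [iteratedDerivWithin_succ (n := 1)]
  · have := h2 x hx y hy
    norm_num at this
    exact this

lemma exists_taylor_bound {f f' f'' : ℝ → ℝ}
    (h1 : ∀ x ∈ Icc (0 : ℝ) 1, HasDerivWithinAt f (f' x) (Icc 0 1) x)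
    (h2 : ∀ x ∈ Icc (0 : ℝ) 1, HasDerivWithinAt f' (f'' x) (Icc 0 1) x)
    {L : ℝ} (hL : ∀ x ∈ Icc (0 : ℝ) 1, ∀ y ∈ Icc (0 : ℝ) 1, |f'' x - f'' y| ≤ L * |x - y|) :
    ∃ M > 0, ∀ x ∈ Icc (0 : ℝ) 1, ∀ y ∈ Icc (0 : ℝ) 1,
      |f y - f x - f' x * (y - x)| ≤ M * (y - x) ^ 2 := by
  have h0 : (0 : ℝ) ∈ Icc (0 : ℝ) 1 := by simp
  refine ⟨|f'' 0| + |L| + 1, by positivity, fun x hx y hy => ?_⟩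
  set M := |f'' 0| + |L| + 1
  have hM : 0 ≤ M := by positivity
  have hb : ∀ z ∈ Icc (0 : ℝ) 1, ‖f'' z‖ ≤ M := by
    intro z hz
    have := hL z hz 0 h0
    rw [sub_zero, abs_of_nonneg hz.1] at this
    have h3 : L * z ≤ |L| := by
      calc L * z ≤ |L| * z := mul_le_mul_of_nonneg_right (le_abs_self _) hz.1
        _ ≤ |L| * 1 := mul_le_mul_of_nonneg_left hz.2 (abs_nonneg _)
        _ = |L| := mul_one _
    have h4 : |f'' z| ≤ |f'' z - f'' 0| + |f'' 0| := by
      simpa using abs_add_le (f'' z - f'' 0) (f'' 0)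
    rw [Real.norm_eq_abs]
    linarith
  have hlip : ∀ a ∈ Icc (0 : ℝ) 1, ∀ b ∈ Icc (0 : ℝ) 1, |f' b - f' a| ≤ M * |b - a| := by
    intro a ha b hb'
    exact (convex_Icc (0 : ℝ) 1).norm_image_sub_le_of_norm_hasDerivWithin_le h2 hb ha hb'
  have hsub : uIcc x y ⊆ Icc (0 : ℝ) 1 := uIcc_subset_Icc hx hy
  -- The mean value inequality is applied to `f` minus its tangent slope at `x`, whose derivative on
  -- the segment from `x` to `y` is at most `M |y - x|`.
  have key := (convex_uIcc x y).norm_image_sub_le_of_norm_hasDerivWithin_le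
    (f := fun z => f z - f' x * z) (f' := fun z => f' z - f' x) (C := M * |y - x|)
    (fun z hz => by
      have := ((h1 z (hsub hz)).mono hsub).sub
        ((hasDerivWithinAt_id z (uIcc x y)).const_mul (f' x))
      rw [mul_one] at this
      exact this)
    (fun z hz => by
      refine (hlip x hx z (hsub hz)).trans (mul_le_mul_of_nonneg_left ?_ hM)
      exact abs_sub_left_of_mem_uIcc hz) left_mem_uIcc right_mem_uIcc
  rw [Real.norm_eq_abs, Real.norm_eq_abs, mul_assoc, ← sq, sq_abs] at key
  convert key using 2
  ring

/-- A positive exponent suffices for `φ ^ p → 0`. The inner function `φ` is `x` at the left endpoint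
and `1 - x` at the right one. -/
lemma tendsto_of_isLittleO {g : ℝ → ℝ} {l : Filter ℝ} {φ : ℝ → ℝ} {a p : ℝ} (hp : 1 ≤ p)
    (hφ : Tendsto φ l (𝓝 0))
    (h : (fun x => g x - a * φ x ^ p) =o[l] fun x => φ x ^ p) : Tendsto g l (𝓝 0) := by
  have h1 : Tendsto (fun x => φ x ^ p) l (𝓝 0) := by
    have := hφ.rpow_const (p := p) (Or.inr (by linarith))
    rwa [Real.zero_rpow (by linarith)] at this
  have h2 := h.trans_tendsto h1
  have := h2.add (h1.const_mul a)
  simpa using this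

lemma BC1.eq_zero {f : ℝ → ℝ} (h : BC1 f) (hc : ContinuousOn (der 1 f) (Icc 0 1)) :
    der 1 f 0 = 0 := by
  obtain ⟨a, p, hp, h⟩ := h
  have h0 : Tendsto (fun x : ℝ => x) (𝓝[>] 0) (𝓝 0) := tendsto_id.mono_left nhdsWithin_le_nhds
  have h1 := tendsto_of_isLittleO (φ := fun x => x) hp h0 h
  have h2 : Tendsto (der 1 f) (𝓝[>] 0) (𝓝 (der 1 f 0)) := by
    refine (hc 0 (by simp)).mono_left ?_
    rw [← nhdsWithin_Ioc_eq_nhdsGT (zero_lt_one : (0 : ℝ) < 1)]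
    exact nhdsWithin_mono _ Ioc_subset_Icc_self
  exact tendsto_nhds_unique h2 h1

lemma BC2.eq_zero {f : ℝ → ℝ} (h : BC2 f) (hc : ContinuousOn (der 1 f) (Icc 0 1)) :
    der 1 f 1 = 0 := by
  obtain ⟨a, p, hp, h⟩ := h
  have h0 : Tendsto (fun x : ℝ => 1 - x) (𝓝[<] 1) (𝓝 0) := by
    have : Tendsto (fun x : ℝ => 1 - x) (𝓝 1) (𝓝 (1 - 1)) := by
      exact Continuous.tendsto (by fun_prop) 1
    rw [sub_self] at this
    exact this.mono_left nhdsWithin_le_nhds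
  have h1 := tendsto_of_isLittleO (φ := fun x => 1 - x) hp h0 h
  have h2 : Tendsto (der 1 f) (𝓝[<] 1) (𝓝 (der 1 f 1)) := by
    refine (hc 1 (by simp)).mono_left ?_
    rw [← nhdsWithin_Ico_eq_nhdsLT (zero_lt_one : (0 : ℝ) < 1)]
    exact nhdsWithin_mono _ Ico_subset_Icc_self
  exact tendsto_nhds_unique h2 h1

/-- A nonnegative `C^{1,1}` function on `[0,1]` with vanishing derivatives at the endpoints and
integrable inverse is bounded away from zero. -/
lemma exists_pos_lower_bound {f f' : ℝ → ℝ} {M : ℝ} (hMpos : 0 < M)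
    (h1 : ∀ x ∈ Icc (0 : ℝ) 1, HasDerivWithinAt f (f' x) (Icc 0 1) x)
    (hM : ∀ x ∈ Icc (0 : ℝ) 1, ∀ y ∈ Icc (0 : ℝ) 1,
      |f y - f x - f' x * (y - x)| ≤ M * (y - x) ^ 2)
    (h0 : f' 0 = 0) (h1' : f' 1 = 0) (hf : ∀ x ∈ Icc (0 : ℝ) 1, 0 ≤ f x)
    (hinv : ∫⁻ x in Icc (0 : ℝ) 1, (ENNReal.ofReal (f x))⁻¹ < ⊤) :
    ∃ δ > 0, ∀ x ∈ Icc (0 : ℝ) 1, δ ≤ f x := by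
  have hc : ContinuousOn f (Icc 0 1) := fun x hx => (h1 x hx).continuousWithinAt
  obtain ⟨x₀, hx₀, hmin⟩ := isCompact_Icc.exists_isMinOn (nonempty_Icc.2 zero_le_one) hc
  refine ⟨f x₀, lt_of_le_of_ne (hf x₀ hx₀) fun heq => ?_, fun x hx => hmin hx⟩
  -- Suppose that the minimum value is zero. The derivative vanishes at the minimizer, by Fermat's
  -- rule inside and by the boundary conditions at the ends, so `f` grows at most quadratically away
  -- from it.
  have hd : f' x₀ = 0 := by
    by_cases ha : x₀ = 0
    · rw [ha, h0]
    by_cases hb : x₀ = 1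
    · rw [hb, h1']
    have hmem : x₀ ∈ Ioo (0 : ℝ) 1 :=
      ⟨lt_of_le_of_ne hx₀.1 (Ne.symm ha), lt_of_le_of_ne hx₀.2 hb⟩
    have hn : Icc (0 : ℝ) 1 ∈ 𝓝 x₀ := Icc_mem_nhds hmem.1 hmem.2
    exact (hmin.isLocalMin hn).hasDerivAt_eq_zero ((h1 x₀ hx₀).hasDerivAt hn)
  have hbound : ∀ x ∈ Icc (0 : ℝ) 1, f x ≤ M * (x - x₀) ^ 2 := by
    intro x hx
    have := hM x₀ hx₀ x hx
    rw [hd, ← heq, zero_mul, sub_zero, sub_zero] at this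
    exact (le_abs_self _).trans this
  -- Since `|x - x₀| ≤ 1`, the quadratic bound gives `|x - x₀|⁻¹ ≤ M / f x` almost everywhere; a
  -- simple pole in `[0,1]` would then be integrable, which is false.
  have hint : IntervalIntegrable (fun x => (x - x₀)⁻¹) volume 0 1 := by
    rw [intervalIntegrable_iff_integrableOn_Icc_of_le zero_le_one]
    refine ⟨by fun_prop, ?_⟩
    refine lt_of_le_of_lt ?_ (ENNReal.mul_lt_top (ENNReal.ofReal_lt_top (r := M)) hinv)
    have hae : ∀ᵐ x ∂volume.restrict (Icc (0 : ℝ) 1), x ≠ x₀ :=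
      ae_restrict_of_ae (compl_mem_ae_iff.2 (measure_singleton x₀))
    rw [← lintegral_const_mul' _ _ ENNReal.ofReal_ne_top]
    refine lintegral_mono_ae ?_
    filter_upwards [ae_restrict_mem measurableSet_Icc, hae] with x hx hne
    have hpos : 0 < |x - x₀| := abs_pos.2 (sub_ne_zero.2 hne)
    have hle : |x - x₀| ≤ 1 := by
      rw [abs_le]
      constructor <;> linarith [hx.1, hx.2, hx₀.1, hx₀.2]
    rw [← ofReal_norm, Real.norm_eq_abs, abs_inv]
    rcases (hf x hx).eq_or_lt with hz | hz
    · rw [← hz, ENNReal.ofReal_zero, ENNReal.inv_zero, ENNReal.mul_top (by simpa using hMpos)]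
      exact le_top
    · rw [← ENNReal.ofReal_inv_of_pos hz, ← ENNReal.ofReal_mul hMpos.le]
      apply ENNReal.ofReal_le_ofReal
      rw [inv_le_iff_one_le_mul₀ hpos, mul_assoc, mul_comm, mul_assoc, ← div_eq_inv_mul,
        le_div_iff₀ hz, one_mul]
      refine (hbound x hx).trans ?_
      rw [mul_comm]
      refine mul_le_mul_of_nonneg_right ?_ hMpos.le
      rw [← sq_abs, sq]
      exact mul_le_of_le_one_left hpos.le hle
  rw [intervalIntegrable_sub_inv_iff] at hint
  rcases hint with h | h
  · exact zero_ne_one h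
  · exact h (by rwa [uIcc_of_le zero_le_one])

/-! ### Polygons approximate no better than `k⁻²` in `L¹` -/

/-- A continuous function without zeros on an interval keeps its sign. Recording the sign as a
factor `s` treats the convex and the concave case together. -/
lemma exists_sign_interval {g : ℝ → ℝ} {u v c L : ℝ} (hu : 0 ≤ u) (hv : v ≤ 1)
    (hc : 0 < c) (hg : ∀ x ∈ Ioo u v, c ≤ |g x|)
    (hL : ∀ x ∈ Icc (0 : ℝ) 1, ∀ y ∈ Icc (0 : ℝ) 1, |g x - g y| ≤ L * |x - y|) :
    ∃ s : ℝ, |s| = 1 ∧ ∀ x ∈ Ioo u v, c ≤ s * g x := by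
  have hsub : Ioo u v ⊆ Icc (0 : ℝ) 1 := fun x hx => ⟨hu.trans hx.1.le, hx.2.le.trans hv⟩
  have hcont : ContinuousOn g (Ioo u v) := by
    have : LipschitzOnWith (Real.toNNReal L) g (Ioo u v) := by
      refine LipschitzOnWith.of_dist_le_mul fun x hx y hy => ?_
      rw [Real.dist_eq, Real.dist_eq]
      exact (hL x (hsub hx) y (hsub hy)).trans
        (mul_le_mul_of_nonneg_right (Real.le_coe_toNNReal L) (abs_nonneg _))
    exact this.continuousOn
  have hne : ∀ x ∈ Ioo u v, g x ≠ 0 := fun x hx h0 => by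
    have := hg x hx
    rw [h0, abs_zero] at this
    linarith
  by_cases hpos : ∀ x ∈ Ioo u v, 0 < g x
  · exact ⟨1, abs_one, fun x hx => by simpa [abs_of_pos (hpos x hx)] using hg x hx⟩
  · push Not at hpos
    obtain ⟨y, hy, hy0⟩ := hpos
    refine ⟨-1, by simp, fun x hx => ?_⟩
    have hx0 : g x < 0 := by
      by_contra hx0
      push Not at hx0
      obtain ⟨z, hz, hz0⟩ := isPreconnected_Ioo.intermediate_value hy hx hcont ⟨hy0, hx0⟩
      exact hne z hz hz0
    have := hg x hx
    rw [abs_of_neg hx0] at this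
    linarith

/-- The function `s f - (c/2) y²` is convex. Midpoint convexity at `x, x + t, x + 2t` gives the
claim, as the second difference of `(c/2) y²` is exactly `c t²`. -/
lemma second_difference_ge {f f' f'' : ℝ → ℝ} {u v c s : ℝ}
    (h1 : ∀ x ∈ Ioo u v, HasDerivAt f (f' x) x) (h2 : ∀ x ∈ Ioo u v, HasDerivAt f' (f'' x) x)
    (hc : ∀ x ∈ Ioo u v, c ≤ s * f'' x) {x t : ℝ} (hx : x ∈ Ioo u v)
    (hxt : x + 2 * t ∈ Ioo u v) :
    c * t ^ 2 ≤ s * (f x - 2 * f (x + t) + f (x + 2 * t)) := by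
  have d1 : ∀ y ∈ Ioo u v, HasDerivAt (fun y => s * f y - c / 2 * y ^ 2) (s * f' y - c * y) y := by
    intro y hy
    have := ((h1 y hy).const_mul s).sub (((hasDerivAt_id y).pow 2).const_mul (c / 2))
    refine this.congr_deriv ?_
    simp only [id_eq, Nat.cast_ofNat]
    ring
  have d2 : ∀ y ∈ Ioo u v, HasDerivAt (fun y => s * f' y - c * y) (s * f'' y - c) y := by
    intro y hy
    have := ((h2 y hy).const_mul s).sub ((hasDerivAt_id y).const_mul c)
    rw [mul_one] at this
    exact this
  have hconv : ConvexOn ℝ (Ioo u v) (fun y => s * f y - c / 2 * y ^ 2) := by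
    refine convexOn_of_hasDerivWithinAt2_nonneg (convex_Ioo u v)
      (fun y hy => (d1 y hy).continuousAt.continuousWithinAt)
      (f' := fun y => s * f' y - c * y) (f'' := fun y => s * f'' y - c)
      (fun y hy => ?_) (fun y hy => ?_) fun y hy => ?_
    all_goals rw [interior_Ioo] at hy
    · exact (d1 y hy).hasDerivWithinAt
    · exact (d2 y hy).hasDerivWithinAt
    · linarith [hc y hy]
  have key := hconv.2 hx hxt (by norm_num : (0 : ℝ) ≤ 1 / 2) (by norm_num : (0 : ℝ) ≤ 1 / 2)
    (by norm_num)
  simp only [smul_eq_mul] at key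
  rw [show 1 / 2 * x + 1 / 2 * (x + 2 * t) = x + t by ring] at key
  nlinarith [key]

/-- Second differences annihilate the affine `p`, so the errors at `x, x + d, x + 2d` with weights
`1, 2, 1` dominate the second difference of `f`. Integrating over the first third of the interval
covers it by three translates; the weight `2` costs the factor `1/2`. -/
lemma integral_abs_affine_sub_ge {f f' f'' p : ℝ → ℝ} {u v c s A B a d : ℝ}
    (h1 : ∀ x ∈ Ioo u v, HasDerivAt f (f' x) x) (h2 : ∀ x ∈ Ioo u v, HasDerivAt f' (f'' x) x)
    (hs : |s| = 1) (hc : ∀ x ∈ Ioo u v, c ≤ s * f'' x) (hd : 0 < d)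
    (hsub : Ioo a (a + 3 * d) ⊆ Ioo u v) (hp : ∀ x ∈ Ioo a (a + 3 * d), p x = A + B * x)
    (hint : IntervalIntegrable (fun x => |p x - f x|) volume a (a + 3 * d)) :
    c * d ^ 3 / 2 ≤ ∫ x in a..a + 3 * d, |p x - f x| := by
  set g := fun x => |p x - f x| with hg
  have hI : ∀ y z, a ≤ y → y ≤ z → z ≤ a + 3 * d → IntervalIntegrable g volume y z := by
    intro y z h1 h2 h3
    refine hint.mono_set ?_
    rw [uIcc_of_le h2, uIcc_of_le (by linarith)]
    exact Icc_subset_Icc h1 h3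
  have i1 := hI a (a + d) le_rfl (by linarith) (by linarith)
  have i2 := hI (a + d) (a + 2 * d) (by linarith) (by linarith) (by linarith)
  have i3 := hI (a + 2 * d) (a + 3 * d) (by linarith) (by linarith) (by linarith)
  have j2 : IntervalIntegrable (fun x => g (x + d)) volume a (a + d) := by
    have := i2.comp_add_right d
    rwa [show a + d - d = a by ring, show a + 2 * d - d = a + d by ring] at this
  have j3 : IntervalIntegrable (fun x => g (x + 2 * d)) volume a (a + d) := by
    have := i3.comp_add_right (2 * d)
    rwa [show a + 2 * d - 2 * d = a by ring, show a + 3 * d - 2 * d = a + d by ring] at this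
  have hpt : ∀ x ∈ Ioo a (a + d), c * d ^ 2 ≤ g x + 2 * g (x + d) + g (x + 2 * d) := by
    intro x hx
    have m0 : x ∈ Ioo a (a + 3 * d) := ⟨hx.1, by linarith [hx.2]⟩
    have m1 : x + d ∈ Ioo a (a + 3 * d) := ⟨by linarith [hx.1], by linarith [hx.2]⟩
    have m2 : x + 2 * d ∈ Ioo a (a + 3 * d) := ⟨by linarith [hx.1], by linarith [hx.2]⟩
    refine (second_difference_ge h1 h2 hc (hsub m0) (hsub m2)).trans ?_
    have e : f x - 2 * f (x + d) + f (x + 2 * d)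
        = -(p x - f x) + 2 * (p (x + d) - f (x + d)) - (p (x + 2 * d) - f (x + 2 * d)) := by
      rw [hp x m0, hp _ m1, hp _ m2]
      ring
    calc s * (f x - 2 * f (x + d) + f (x + 2 * d))
        ≤ |s * (f x - 2 * f (x + d) + f (x + 2 * d))| := le_abs_self _
      _ = |-(p x - f x) + 2 * (p (x + d) - f (x + d)) - (p (x + 2 * d) - f (x + 2 * d))| := by
          rw [abs_mul, hs, one_mul, e]
      _ ≤ g x + 2 * g (x + d) + g (x + 2 * d) := by
          refine (abs_sub _ _).trans (add_le_add_left ((abs_add_le _ _).trans ?_) _)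
          rw [abs_neg, abs_mul, abs_two]
  have hle : ∫ _ in a..a + d, c * d ^ 2
      ≤ ∫ x in a..a + d, (g x + 2 * g (x + d) + g (x + 2 * d)) :=
    intervalIntegral.integral_mono_on_of_le_Ioo (by linarith) (by simp)
      ((i1.add (j2.const_mul 2)).add j3) hpt
  rw [intervalIntegral.integral_const, intervalIntegral.integral_add (i1.add (j2.const_mul 2)) j3,
    intervalIntegral.integral_add i1 (j2.const_mul 2), intervalIntegral.integral_const_mul,
    intervalIntegral.integral_comp_add_right, intervalIntegral.integral_comp_add_right g,
    show a + d + d = a + 2 * d by ring, show a + d + 2 * d = a + 3 * d by ring, smul_eq_mul,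
    show a + d - a = d by ring] at hle
  rw [← intervalIntegral.integral_add_adjacent_intervals i1 (i2.trans i3),
    ← intervalIntegral.integral_add_adjacent_intervals i2 i3]
  have n1 : 0 ≤ ∫ x in a..a + d, g x :=
    intervalIntegral.integral_nonneg (by linarith) fun _ _ => abs_nonneg _
  have n3 : 0 ≤ ∫ x in a + 2 * d..a + 3 * d, g x :=
    intervalIntegral.integral_nonneg (by linarith) fun _ _ => abs_nonneg _
  nlinarith [hle, n1, n3]

/-- Polygons with `m + 1` bins approximate a function whose second derivative is bounded away from
zero on an interval no better than at the order `(m + 1)⁻²`. -/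
lemma exists_l1Dist_polygon_ge {f f' f'' : ℝ → ℝ} {u v c s : ℝ} (hu : 0 ≤ u) (huv : u < v)
    (hv : v ≤ 1) (hc0 : 0 < c) (hf : ContinuousOn f (Icc 0 1))
    (h1 : ∀ x ∈ Ioo u v, HasDerivAt f (f' x) x) (h2 : ∀ x ∈ Ioo u v, HasDerivAt f' (f'' x) x)
    (hs : |s| = 1) (hc : ∀ x ∈ Ioo u v, c ≤ s * f'' x) :
    ∃ C > 0, ∀ (m : ℕ) (w : Fin (m + 1) → ℝ),
      C / ((m : ℝ) + 1) ^ 2 ≤ l1Dist (polygon m w) f := by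
  -- An interval `[r/R, (r+1)/R]` inside `[u, v]`, chosen independently of `m`. Rational endpoints
  -- make a subdivision compatible with the half bins for every `m`.
  obtain ⟨R, hR⟩ := exists_nat_gt (2 / (v - u))
  have hvu : 0 < v - u := sub_pos.2 huv
  have hR0 : (0 : ℝ) < R := lt_trans (by positivity) hR
  rw [div_lt_iff₀ hvu] at hR
  set r := ⌈u * R⌉₊ with hr
  have hr1 : u * R ≤ r := Nat.le_ceil _
  have hr2 : (r : ℝ) < u * R + 1 := Nat.ceil_lt_add_one (by positivity)
  have hr3 : (r : ℝ) + 1 ≤ v * R := by linarith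
  have hr4 : r + 1 ≤ R := by
    have : (r : ℝ) + 1 ≤ R := hr3.trans (mul_le_of_le_one_left hR0.le hv)
    exact_mod_cast this
  -- The interval consists of `2(m + 1)` cells of length `3d`, each contributing `c d³ / 2` with `d
  -- = 1 / (6 (m + 1) R)`.
  refine ⟨c / (216 * R ^ 3), by positivity, fun m w => ?_⟩
  have hk : (0 : ℝ) < (m : ℝ) + 1 := by positivity
  set d : ℝ := 1 / (6 * ((m : ℝ) + 1) * R) with hd
  have hd0 : 0 < d := by positivity
  have hd3 : 3 * d * (2 * ((m : ℝ) + 1) * R) = 1 := by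
    rw [hd]; field_simp; norm_num
  set z : ℕ → ℝ := fun i => (r : ℝ) / R + 3 * d * i with hz
  have hzs : ∀ i, z (i + 1) = z i + 3 * d := by
    intro i; simp only [hz]; push_cast; ring
  have hz' : ∀ i, z i * (2 * ((m : ℝ) + 1) * R) = 2 * ((m : ℝ) + 1) * r + i := by
    intro i
    simp only [hz]
    rw [add_mul, mul_right_comm (3 * d), hd3]
    field_simp
  have hzend : z (2 * (m + 1)) = ((r : ℝ) + 1) / R := by
    have := hz' (2 * (m + 1))
    push_cast at this
    rw [eq_div_iff hR0.ne']
    have h : (z (2 * (m + 1)) * R - (r + 1)) * (2 * ((m : ℝ) + 1)) = 0 := by linarith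
    rcases mul_eq_zero.1 h with h | h
    · linarith
    · linarith
  have hz0 : z 0 = (r : ℝ) / R := by simp [hz]
  have hzmono : Monotone z := monotone_nat_of_le_succ fun i => by rw [hzs]; linarith
  have hlo : u ≤ z 0 := by rw [hz0, le_div_iff₀ hR0]; exact hr1
  have hhi : z (2 * (m + 1)) ≤ v := by rw [hzend, div_le_iff₀ hR0]; exact hr3
  have hgint : IntegrableOn (fun x => |polygon m w x - f x|) (Icc 0 1) :=
    ((integrable_polygon m w).integrableOn.sub (hf.integrableOn_Icc)).abs
  have hII : ∀ i, i < 2 * (m + 1) →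
      IntervalIntegrable (fun x => |polygon m w x - f x|) volume (z i) (z (i + 1)) := by
    intro i hi
    rw [intervalIntegrable_iff_integrableOn_Icc_of_le (hzmono (Nat.le_succ i))]
    exact hgint.mono_set (Icc_subset_Icc (hu.trans (hlo.trans (hzmono (Nat.zero_le i))))
      ((hzmono (by omega : i + 1 ≤ 2 * (m + 1))).trans (hhi.trans hv)))
  have hcell : ∀ i, i < 2 * (m + 1) →
      c * d ^ 3 / 2 ≤ ∫ x in z i..z (i + 1), |polygon m w x - f x| := by
    intro i hi
    -- The number of the cell in the grid of mesh `1 / (2 (m + 1) R)` on `[0,1]`. This grid refines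
    -- that of the half bins by the factor `R`, so the cell lies in half bin `N / R`, where the
    -- polygon is affine.
    set N := 2 * (m + 1) * r + i with hN
    have hNR : N < 2 * (m + 1) * R := by
      calc N < 2 * (m + 1) * r + 2 * (m + 1) := by omega
        _ = 2 * (m + 1) * (r + 1) := by ring
        _ ≤ _ := Nat.mul_le_mul_left _ hr4
    have hRn : 0 < R := by exact_mod_cast hR0
    have hq : N / R < 2 * (m + 1) := Nat.div_lt_of_lt_mul (by rwa [mul_comm])
    obtain ⟨A, B, hAB⟩ := exists_affine_polygon w hq
    have hq1 : ((N / R : ℕ) : ℝ) * R ≤ N := by exact_mod_cast Nat.div_mul_le_self N R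
    have hq2 : (N : ℝ) + 1 ≤ (((N / R : ℕ) : ℝ) + 1) * R := by
      have := Nat.lt_div_mul_add hRn (a := N)
      have h : N + 1 ≤ (N / R + 1) * R := by rw [add_mul, one_mul]; omega
      exact_mod_cast h
    have hNc : (N : ℝ) = z i * (2 * ((m : ℝ) + 1) * R) := by
      rw [hz', hN]; push_cast; ring
    rw [hzs]
    refine integral_abs_affine_sub_ge (A := A) (B := B) h1 h2 hs hc hd0 ?_ (fun x hx => hAB x ?_) ?_
    · rw [← hzs]
      exact Ioo_subset_Ioo (hlo.trans (hzmono (Nat.zero_le i)))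
        ((hzmono (by omega : i + 1 ≤ 2 * (m + 1))).trans hhi)
    · constructor
      · rw [div_lt_iff₀ (by positivity)]
        refine lt_of_mul_lt_mul_right ?_ hR0.le
        refine hq1.trans_lt ?_
        rw [hNc, mul_assoc x]
        exact mul_lt_mul_of_pos_right hx.1 (by positivity)
      · rw [lt_div_iff₀ (by positivity)]
        refine lt_of_mul_lt_mul_right (lt_of_lt_of_le ?_ hq2) hR0.le
        have := mul_lt_mul_of_pos_right hx.2 (by positivity : 0 < 2 * ((m : ℝ) + 1) * R)
        rw [add_mul, hd3] at this
        rwa [hNc, mul_assoc x]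
    · rw [← hzs]; exact hII i hi
  have hsum := intervalIntegral.sum_integral_adjacent_intervals (a := z) (n := 2 * (m + 1)) hII
  have hge : (2 * (m + 1) : ℕ) • (c * d ^ 3 / 2)
      ≤ ∑ i ∈ Finset.range (2 * (m + 1)), ∫ x in z i..z (i + 1), |polygon m w x - f x| := by
    have := Finset.card_nsmul_le_sum (Finset.range (2 * (m + 1))) _ (c * d ^ 3 / 2)
      fun i hi => hcell i (Finset.mem_range.1 hi)
    rwa [Finset.card_range] at this
  rw [hsum, intervalIntegral.integral_of_le (hzmono (Nat.zero_le _))] at hge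
  have hfin : ∫ x in Ioc (z 0) (z (2 * (m + 1))), |polygon m w x - f x|
      ≤ l1Dist (polygon m w) f := by
    refine setIntegral_mono_set hgint (Eventually.of_forall fun _ => abs_nonneg _) ?_
    exact (Ioc_subset_Icc_self.trans
      (Icc_subset_Icc (hu.trans hlo) (hhi.trans hv))).eventuallyLE
  refine le_trans (le_of_eq ?_) (hge.trans hfin)
  rw [nsmul_eq_mul, hd]
  push_cast
  field_simp
  norm_num

/-! ### Uniform approximation by polygons with suitable weights -/

lemma mid_mem_Icc (m : ℕ) (j : Fin (m + 1)) : mid m j ∈ Icc (0 : ℝ) 1 :=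
  ⟨(mid_pos m j).le, (mid_mono m (Fin.le_last j)).trans (mid_last_le_one m)⟩

/-- A polygon whose nodes are close to the graph of a `C^{1,1}` function with vanishing derivatives
at the endpoints is uniformly close to it. -/
lemma abs_polygon_sub_le {f f' : ℝ → ℝ} {M E : ℝ} (hM0 : 0 < M)
    (hM : ∀ x ∈ Icc (0 : ℝ) 1, ∀ y ∈ Icc (0 : ℝ) 1,
      |f y - f x - f' x * (y - x)| ≤ M * (y - x) ^ 2)
    (h0 : f' 0 = 0) (h1 : f' 1 = 0) {m : ℕ} {w : Fin (m + 1) → ℝ}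
    (hw : ∀ i, |w i * ((m : ℝ) + 1) - f (mid m i)| ≤ E) {x : ℝ} (hx : x ∈ Icc (0 : ℝ) 1) :
    |polygon m w x - f x| ≤ E + 2 * M / ((m : ℝ) + 1) ^ 2 := by
  have hk : (0 : ℝ) < (m : ℝ) + 1 := by positivity
  set h : ℝ := 1 / ((m : ℝ) + 1) with hh
  have hpos : 0 < h := by positivity
  have hkh : ((m : ℝ) + 1) * h = 1 := by rw [hh]; field_simp
  have hE : E + 2 * M / ((m : ℝ) + 1) ^ 2 = E + 2 * M * h ^ 2 := by
    rw [hh]; field_simp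
  rw [hE]
  -- On a flat end piece, `f c` and `f x` are both within `M h²` of the value at the endpoint `e`,
  -- because `f' e = 0`. Without this the error would be of order `h`.
  have hend : ∀ e ∈ Icc (0 : ℝ) 1, f' e = 0 → ∀ c ∈ Icc (0 : ℝ) 1, ∀ y, |c - e| ≤ h →
      |x - e| ≤ h → |y - f c| ≤ E → |y - f x| ≤ E + 2 * M * h ^ 2 := by
    intro e he hfe c hc y hce hxe hy
    have t1 := hM e he c hc
    have t2 := hM e he x hx
    rw [hfe, zero_mul, sub_zero] at t1 t2
    have s1 : (c - e) ^ 2 ≤ h ^ 2 := sq_le_sq' (by linarith [(abs_le.1 hce).1]) (abs_le.1 hce).2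
    have s2 : (x - e) ^ 2 ≤ h ^ 2 := sq_le_sq' (by linarith [(abs_le.1 hxe).1]) (abs_le.1 hxe).2
    have s3 := mul_le_mul_of_nonneg_left s1 hM0.le
    have s4 := mul_le_mul_of_nonneg_left s2 hM0.le
    rw [abs_le] at *
    constructor <;> linarith [t1.1, t1.2, t2.1, t2.2, hy.1, hy.2]
  rcases unitInterval_cases m x with hc | ⟨j, hj⟩ | hc
  · rw [polygon_of_le_mid_zero w hx.1 hc]
    have hm : mid m 0 ≤ h := by
      simp only [mid, hh, Fin.val_zero]
      gcongr
      norm_num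
    refine hend 0 (by simp) h0 _ (mid_mem_Icc m 0) _ ?_ ?_ (hw 0)
    · rwa [sub_zero, abs_of_pos (mid_pos m 0)]
    · rw [sub_zero, abs_of_nonneg hx.1]
      exact hc.trans hm
  · rw [polygon_of_mem_Ioc w j hj]
    set c := mid m j.castSucc with hcdef
    set c' := mid m j.succ with hcdef'
    have hcc : c' - c = h := by
      simp only [hcdef, hcdef', mid, hh, Fin.val_castSucc, Fin.val_succ]
      push_cast
      ring
    have t1 := hM x hx c (mid_mem_Icc m _)
    have t2 := hM x hx c' (mid_mem_Icc m _)
    have s1 : (c - x) ^ 2 ≤ h ^ 2 := sq_le_sq' (by linarith [hj.2]) (by linarith [hj.1])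
    have s2 : (c' - x) ^ 2 ≤ h ^ 2 := sq_le_sq' (by linarith [hj.2]) (by linarith [hj.1])
    have s3 := mul_le_mul_of_nonneg_left s1 hM0.le
    have s4 := mul_le_mul_of_nonneg_left s2 hM0.le
    have w1 := hw j.castSucc
    have w2 := hw j.succ
    set a := w j.castSucc * ((m : ℝ) + 1)
    set b := w j.succ * ((m : ℝ) + 1)
    set l := ((m : ℝ) + 1) * (c' - x) with hl
    set l' := ((m : ℝ) + 1) * (x - c) with hl'
    have hl0 : 0 ≤ l := mul_nonneg hk.le (by linarith [hj.2])
    have hl0' : 0 ≤ l' := mul_nonneg hk.le (by linarith [hj.1])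
    have hll : l + l' = 1 := by
      rw [← hkh, ← hcc, hl, hl']; ring
    -- The interpolation weights reproduce `x` as a convex combination of the two nodes, so the
    -- first-order Taylor terms cancel.
    have hlin : l * (c - x) + l' * (c' - x) = 0 := by rw [hl, hl']; ring
    have e1 : |a - f x - f' x * (c - x)| ≤ E + M * h ^ 2 := by
      rw [abs_le] at *
      constructor <;> linarith [t1.1, t1.2, w1.1, w1.2]
    have e2 : |b - f x - f' x * (c' - x)| ≤ E + M * h ^ 2 := by
      rw [abs_le] at *
      constructor <;> linarith [t2.1, t2.2, w2.1, w2.2]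
    have heq : (l * w j.castSucc + l' * w j.succ) * ((m : ℝ) + 1) - f x
        = l * (a - f x - f' x * (c - x)) + l' * (b - f x - f' x * (c' - x)) := by
      have : f x = (l + l') * f x := by rw [hll, one_mul]
      have h2 : f' x * (l * (c - x) + l' * (c' - x)) = 0 := by rw [hlin, mul_zero]
      linear_combination (-1 : ℝ) * this + h2
    rw [heq]
    calc |l * (a - f x - f' x * (c - x)) + l' * (b - f x - f' x * (c' - x))|
        ≤ l * (E + M * h ^ 2) + l' * (E + M * h ^ 2) := by
          refine (abs_add_le _ _).trans (add_le_add ?_ ?_)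
          · rw [abs_mul, abs_of_nonneg hl0]
            exact mul_le_mul_of_nonneg_left e1 hl0
          · rw [abs_mul, abs_of_nonneg hl0']
            exact mul_le_mul_of_nonneg_left e2 hl0'
      _ = E + M * h ^ 2 := by rw [← add_mul, hll, one_mul]
      _ ≤ E + 2 * M * h ^ 2 := by
          have : 0 ≤ M * h ^ 2 := by positivity
          linarith
  · rw [polygon_of_mid_last_lt w hc hx.2]
    have hm : 1 - mid m (Fin.last m) ≤ h := by
      have : 1 - mid m (Fin.last m) = h / 2 := by
        simp only [mid, hh, Fin.val_last]
        field_simp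
        ring
      linarith
    refine hend 1 (by simp) h1 _ (mid_mem_Icc m (Fin.last m)) _ ?_ ?_ (hw (Fin.last m))
    · rw [abs_sub_comm, abs_of_nonneg (sub_nonneg.2 (mid_last_le_one m))]
      exact hm
    · rw [abs_sub_comm, abs_of_nonneg (sub_nonneg.2 hx.2)]
      linarith

/-- The integral of a function over the `j`-th bin. -/
noncomputable def binIntegral (f : ℝ → ℝ) (m : ℕ) (j : Fin (m + 1)) : ℝ :=
  ∫ x in ((j : ℝ) / ((m : ℝ) + 1))..(((j : ℝ) + 1) / ((m : ℝ) + 1)), f x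

lemma bin_endpoints (m : ℕ) (j : Fin (m + 1)) :
    0 ≤ (j : ℝ) / ((m : ℝ) + 1) ∧
    (j : ℝ) / ((m : ℝ) + 1) ≤ ((j : ℝ) + 1) / ((m : ℝ) + 1) ∧
    ((j : ℝ) + 1) / ((m : ℝ) + 1) ≤ 1 := by
  have hk : (0 : ℝ) < (m : ℝ) + 1 := by positivity
  have hj : (j : ℝ) ≤ m := by exact_mod_cast Nat.lt_succ_iff.1 j.2
  refine ⟨by positivity, ?_, ?_⟩
  · gcongr
    linarith
  · rw [div_le_one hk]
    linarith

lemma intervalIntegrable_bin {f : ℝ → ℝ} (hf : ContinuousOn f (Icc 0 1)) (m : ℕ)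
    (j : Fin (m + 1)) :
    IntervalIntegrable f volume ((j : ℝ) / ((m : ℝ) + 1)) (((j : ℝ) + 1) / ((m : ℝ) + 1)) := by
  obtain ⟨h1, h2, h3⟩ := bin_endpoints m j
  refine (hf.mono ?_).intervalIntegrable
  rw [uIcc_of_le h2]
  exact Icc_subset_Icc h1 h3

lemma sum_binIntegral {f : ℝ → ℝ} (hf : ContinuousOn f (Icc 0 1)) (m : ℕ) :
    ∑ j, binIntegral f m j = ∫ x in Icc (0 : ℝ) 1, f x := by
  have hk : (0 : ℝ) < (m : ℝ) + 1 := by positivity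
  have h := intervalIntegral.sum_integral_adjacent_intervals (f := f) (μ := volume)
    (a := fun i : ℕ => (i : ℝ) / ((m : ℝ) + 1)) (n := m + 1) (fun i hi => by
      have := intervalIntegrable_bin hf m ⟨i, hi⟩
      simpa using this)
  rw [integral_Icc_eq_integral_Ioc, ← intervalIntegral.integral_of_le zero_le_one]
  push_cast at h
  rw [zero_div, div_self hk.ne'] at h
  rw [← h, Finset.sum_range]
  rfl

lemma const_mul_le_binIntegral {f : ℝ → ℝ} (hf : ContinuousOn f (Icc 0 1)) {δ U : ℝ}
    (hδ : ∀ x ∈ Icc (0 : ℝ) 1, δ ≤ f x) (hU : ∀ x ∈ Icc (0 : ℝ) 1, f x ≤ U)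
    (m : ℕ) (j : Fin (m + 1)) :
    δ / ((m : ℝ) + 1) ≤ binIntegral f m j ∧ binIntegral f m j ≤ U / ((m : ℝ) + 1) := by
  obtain ⟨h1, h2, h3⟩ := bin_endpoints m j
  have hlen : ((j : ℝ) + 1) / ((m : ℝ) + 1) - (j : ℝ) / ((m : ℝ) + 1) = 1 / ((m : ℝ) + 1) := by
    ring
  constructor
  · have := intervalIntegral.integral_mono_on h2 (by simp) (intervalIntegrable_bin hf m j)
      fun x hx => hδ x ⟨h1.trans hx.1, hx.2.trans h3⟩
    rw [intervalIntegral.integral_const, hlen, smul_eq_mul, one_div_mul_eq_div] at this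
    exact this
  · have := intervalIntegral.integral_mono_on h2 (intervalIntegrable_bin hf m j) (by simp)
      fun x hx => hU x ⟨h1.trans hx.1, hx.2.trans h3⟩
    rw [intervalIntegral.integral_const, hlen, smul_eq_mul, one_div_mul_eq_div] at this
    exact this

/-- The linear Taylor term about the midpoint integrates to zero over the bin, which leaves a
quadratic error. -/
lemma abs_binIntegral_sub_le {f f' : ℝ → ℝ} {M : ℝ} (hM0 : 0 < M)
    (hf : ContinuousOn f (Icc 0 1))
    (hM : ∀ x ∈ Icc (0 : ℝ) 1, ∀ y ∈ Icc (0 : ℝ) 1,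
      |f y - f x - f' x * (y - x)| ≤ M * (y - x) ^ 2) (m : ℕ) (j : Fin (m + 1)) :
    |binIntegral f m j * ((m : ℝ) + 1) - f (mid m j)| ≤ M / ((m : ℝ) + 1) ^ 2 := by
  have hk : (0 : ℝ) < (m : ℝ) + 1 := by positivity
  obtain ⟨h1, h2, h3⟩ := bin_endpoints m j
  set s := (j : ℝ) / ((m : ℝ) + 1) with hs
  set t := ((j : ℝ) + 1) / ((m : ℝ) + 1) with ht
  set c := mid m j with hc
  have hst : t - s = 1 / ((m : ℝ) + 1) := by rw [hs, ht]; ring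
  have hct : t - c = (1 / ((m : ℝ) + 1)) / 2 := by rw [hc, ht]; simp only [mid]; ring
  have hcs : c - s = (1 / ((m : ℝ) + 1)) / 2 := by rw [hc, hs]; simp only [mid]; ring
  have hh0 : 0 < 1 / ((m : ℝ) + 1) := by positivity
  have key := intervalIntegral.norm_integral_le_of_norm_le_const (a := s) (b := t)
    (f := fun x => f x - (f c + f' c * (x - c))) (C := M * (1 / ((m : ℝ) + 1)) ^ 2) (by
      intro x hx
      rw [uIoc_of_le h2] at hx
      have := hM c (mid_mem_Icc m j) x ⟨h1.trans hx.1.le, hx.2.trans h3⟩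
      rw [Real.norm_eq_abs, ← sub_sub]
      refine this.trans (mul_le_mul_of_nonneg_left ?_ hM0.le)
      exact sq_le_sq' (by linarith [hx.1]) (by linarith [hx.2]))
  rw [intervalIntegral.integral_sub (intervalIntegrable_bin hf m j)
    (Continuous.intervalIntegrable (by fun_prop) _ _),
    intervalIntegral.integral_add (by simp) (Continuous.intervalIntegrable (by fun_prop) _ _),
    intervalIntegral.integral_const, intervalIntegral.integral_const_mul,
    intervalIntegral.integral_sub (by simp) (by simp), integral_id,
    intervalIntegral.integral_const] at key
  simp only [smul_eq_mul] at key
  have hz : (t ^ 2 - s ^ 2) / 2 - (t - s) * c = 0 := by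
    have : c = (s + t) / 2 := by linarith
    rw [this]; ring
  rw [hz, mul_zero, add_zero, hst, Real.norm_eq_abs, abs_of_pos hh0] at key
  change |binIntegral f m j - _| ≤ _ at key
  have e1 : binIntegral f m j * ((m : ℝ) + 1) - f c
      = (binIntegral f m j - 1 / ((m : ℝ) + 1) * f c) * ((m : ℝ) + 1) := by
    field_simp
  rw [e1, abs_mul, abs_of_pos hk]
  refine (mul_le_mul_of_nonneg_right key hk.le).trans (le_of_eq ?_)
  field_simp

/-- Normalizing a vector within a factor `1 + ε` of a probability vector `u`. -/
lemma abs_div_sum_sub_le {ι : Type*} [Fintype ι] {u g : ι → ℝ} {ε : ℝ}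
    (hu : ∀ i, 0 ≤ u i) (hsum : ∑ i, u i = 1)
    (hg : ∀ i, g i ∈ Icc (u i) (u i * (1 + ε))) (i : ι) :
    |g i / ∑ j, g j - u i| ≤ u i * ε := by
  have hS1 : 1 ≤ ∑ j, g j := hsum ▸ Finset.sum_le_sum fun j _ => (hg j).1
  have hS2 : ∑ j, g j ≤ 1 + ε := by
    refine (Finset.sum_le_sum fun j _ => (hg j).2).trans ?_
    rw [← Finset.sum_mul, hsum, one_mul]
  have hS0 : 0 < ∑ j, g j := by linarith
  have h1 := (hg i).1
  have h2 := (hg i).2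
  rw [abs_le]
  constructor
  · have : u i - u i * ε ≤ g i / ∑ j, g j := by
      rw [le_div_iff₀ hS0]
      -- For `ε ≥ 1` the lower bound is nonpositive; otherwise `(1 - ε)(1 + ε) ≤ 1` is what is
      -- needed.
      by_cases h : 1 - ε ≤ 0
      · have : u i * (1 - ε) * ∑ j, g j ≤ 0 :=
          mul_nonpos_of_nonpos_of_nonneg (mul_nonpos_of_nonneg_of_nonpos (hu i) h) hS0.le
        nlinarith [hu i]
      · push Not at h
        have h3 : (u i - u i * ε) * ∑ j, g j ≤ (u i - u i * ε) * (1 + ε) := by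
          refine mul_le_mul_of_nonneg_left hS2 ?_
          nlinarith [hu i]
        nlinarith [mul_nonneg (hu i) (sq_nonneg ε)]
    linarith
  · have : g i / ∑ j, g j ≤ u i + u i * ε := by
      rw [div_le_iff₀ hS0]
      nlinarith [h1.trans h2, hu i]
    linarith

/-- A bound on the `χ²`-divergence. -/
lemma lintegral_sq_div_le {f p : ℝ → ℝ} {δ e : ℝ} (hδ0 : 0 < δ)
    (hf : IntegrableOn f (Icc 0 1)) (hp : IntegrableOn p (Icc 0 1))
    (hf1 : ∫ x in Icc (0 : ℝ) 1, f x = 1) (hp1 : ∫ x in Icc (0 : ℝ) 1, p x = 1)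
    (hδ : ∀ x ∈ Icc (0 : ℝ) 1, δ ≤ f x) (he : ∀ x ∈ Icc (0 : ℝ) 1, |p x - f x| ≤ e)
    (heδ : e ≤ δ / 2) :
    ∫⁻ x in Icc (0 : ℝ) 1, ENNReal.ofReal (f x ^ 2 / p x)
      ≤ ENNReal.ofReal (Real.exp (2 * e ^ 2 / δ)) := by
  have hpt : ∀ x ∈ Icc (0 : ℝ) 1, 0 ≤ f x ^ 2 / p x ∧
      f x ^ 2 / p x ≤ 2 * f x - p x + 2 * e ^ 2 / δ := by
    intro x hx
    have h1 := abs_le.1 (he x hx)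
    have h2 := hδ x hx
    have hpx : δ / 2 ≤ p x := by linarith
    have hp0 : 0 < p x := by linarith
    refine ⟨by positivity, ?_⟩
    -- In this identity `2f - p` has integral one, so only the quadratic remainder contributes to
    -- the divergence.
    have e1 : f x ^ 2 / p x = 2 * f x - p x + (p x - f x) ^ 2 / p x := by
      field_simp
      ring
    have e2 : (p x - f x) ^ 2 / p x ≤ e ^ 2 / (δ / 2) :=
      div_le_div₀ (sq_nonneg _) (sq_le_sq' h1.1 h1.2) (by positivity) hpx
    have e3 : e ^ 2 / (δ / 2) = 2 * e ^ 2 / δ := by field_simp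
    linarith
  have hint : IntegrableOn (fun x => 2 * f x - p x + 2 * e ^ 2 / δ) (Icc 0 1) := by
    refine ((hf.const_mul 2).sub hp).add ?_
    exact integrableOn_const (by simp)
  calc ∫⁻ x in Icc (0 : ℝ) 1, ENNReal.ofReal (f x ^ 2 / p x)
      ≤ ∫⁻ x in Icc (0 : ℝ) 1, ENNReal.ofReal (2 * f x - p x + 2 * e ^ 2 / δ) :=
        setLIntegral_mono' measurableSet_Icc fun x hx => ENNReal.ofReal_le_ofReal (hpt x hx).2
    _ = ENNReal.ofReal (∫ x in Icc (0 : ℝ) 1, (2 * f x - p x + 2 * e ^ 2 / δ)) := by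
        rw [ofReal_integral_eq_lintegral_ofReal hint]
        filter_upwards [ae_restrict_mem measurableSet_Icc] with x hx
        exact (hpt x hx).1.trans (hpt x hx).2
    _ ≤ _ := by
        apply ENNReal.ofReal_le_ofReal
        have hA : IntegrableOn (fun x => 2 * f x - p x) (Icc 0 1) := (hf.const_mul 2).sub hp
        have hB : IntegrableOn (fun _ => 2 * e ^ 2 / δ) (Icc (0 : ℝ) 1) :=
          integrableOn_const (by simp)
        rw [integral_add hA hB, integral_sub (hf.const_mul 2) hp,
          integral_const_mul, hf1, hp1, setIntegral_const]
        simp only [Real.volume_real_Icc, sub_zero, smul_eq_mul]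
        have := Real.add_one_le_exp (2 * e ^ 2 / δ)
        norm_num
        linarith

/-! ### Small ball probabilities for Gamma vectors -/

/-- Convexity of the Gamma function between `Γ(1) = Γ(2) = 1`. -/
lemma Gamma_one_add_le_one {a : ℝ} (h0 : 0 ≤ a) (h1 : a ≤ 1) : Real.Gamma (a + 1) ≤ 1 := by
  have := Real.convexOn_Gamma.2 (show (1 : ℝ) ∈ Ioi 0 by simp) (show (2 : ℝ) ∈ Ioi 0 by simp)
    (sub_nonneg.2 h1) h0 (by ring)
  simp only [smul_eq_mul, Real.Gamma_one, Real.Gamma_two] at this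
  rw [show (1 - a) * 1 + a * 2 = a + 1 by ring] at this
  linarith

/-- On `(0, 2]` the density is bounded below through `1/Γ(a) = a/Γ(a+1) ≥ a`, `x^(a-1) ≥ 1/2` and
`exp(-x) ≥ exp(-2)`. The bound is linear in `a`, so a shape of order `1/k` costs only a power of
`k`. -/
lemma le_gammaMeasure_Icc {a u v : ℝ} (ha0 : 0 < a) (ha1 : a ≤ 1) (hu : 0 < u) (hv : v ≤ 2) :
    ENNReal.ofReal (a * Real.exp (-2) / 2 * (v - u)) ≤ gammaMeasure a 1 (Icc u v) := by
  rw [gammaMeasure, withDensity_apply _ measurableSet_Icc]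
  have hpt : ∀ x ∈ Icc u v, ENNReal.ofReal (a * Real.exp (-2) / 2) ≤ gammaPDF a 1 x := by
    intro x hx
    have hx0 : 0 < x := hu.trans_le hx.1
    rw [gammaPDF, gammaPDFReal, if_pos hx0.le]
    apply ENNReal.ofReal_le_ofReal
    have hG : a ≤ 1 / Real.Gamma a := by
      rw [le_div_iff₀ (Real.Gamma_pos_of_pos ha0), ← Real.Gamma_add_one ha0.ne']
      exact Gamma_one_add_le_one ha0.le ha1
    have hx2 : (1 : ℝ) / 2 ≤ x ^ (a - 1) := by
      calc (1 : ℝ) / 2 = 2 ^ (-1 : ℝ) := by rw [Real.rpow_neg_one]; norm_num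
        _ ≤ 2 ^ (a - 1) := Real.rpow_le_rpow_of_exponent_le (by norm_num) (by linarith)
        _ ≤ x ^ (a - 1) := Real.rpow_le_rpow_of_nonpos hx0 (hx.2.trans hv) (by linarith)
    have he : Real.exp (-2) ≤ Real.exp (-(1 * x)) :=
      Real.exp_le_exp.2 (by linarith [hx.2])
    rw [Real.one_rpow]
    calc a * Real.exp (-2) / 2 = a * (1 / 2) * Real.exp (-2) := by ring
      _ ≤ 1 / Real.Gamma a * x ^ (a - 1) * Real.exp (-(1 * x)) := by
        gcongr
  calc ENNReal.ofReal (a * Real.exp (-2) / 2 * (v - u))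
      = ∫⁻ _ in Icc u v, ENNReal.ofReal (a * Real.exp (-2) / 2) := by
        rw [setLIntegral_const, Real.volume_Icc, ENNReal.ofReal_mul (by positivity)]
    _ ≤ _ := setLIntegral_mono' measurableSet_Icc hpt

lemma ae_gammaMeasure_nonneg (a : ℝ) : ∀ᵐ x ∂gammaMeasure a 1, 0 ≤ x := by
  rw [ae_iff, gammaMeasure, show {x : ℝ | ¬0 ≤ x} = Iio 0 by ext; simp,
    withDensity_apply _ measurableSet_Iio]
  refine (setLIntegral_congr_fun measurableSet_Iio fun x hx => ?_).trans lintegral_zero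
  exact gammaPDF_of_neg hx

lemma volume_bin (m : ℕ) (j : Fin (m + 1)) :
    MeasurableSet (bin m j) ∧ bin m j ⊆ Icc 0 1 ∧
      volume (bin m j) = ENNReal.ofReal (1 / ((m : ℝ) + 1)) := by
  obtain ⟨h1, h2, h3⟩ := bin_endpoints m j
  by_cases h : j = 0
  · subst h
    simp only [Fin.val_zero, Nat.cast_zero, zero_add] at h3
    simp only [bin, if_true]
    exact ⟨measurableSet_Icc, Icc_subset_Icc le_rfl h3, by rw [Real.volume_Icc, sub_zero]⟩
  · simp only [bin, if_neg h]
    refine ⟨measurableSet_Ioc, fun x hx => ⟨h1.trans hx.1.le, hx.2.trans h3⟩, ?_⟩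
    rw [Real.volume_Ioc]
    congr 1
    ring

lemma measureOfDensity_bin {a : ℝ → ℝ} {l U : ℝ} (hl0 : 0 ≤ l) (hU0 : 0 ≤ U)
    (hl : ∀ x ∈ Icc (0 : ℝ) 1, l ≤ a x) (hU : ∀ x ∈ Icc (0 : ℝ) 1, a x ≤ U)
    (m : ℕ) (j : Fin (m + 1)) :
    l / ((m : ℝ) + 1) ≤ (measureOfDensity a (bin m j)).toReal ∧
      (measureOfDensity a (bin m j)).toReal ≤ U / ((m : ℝ) + 1) := by
  obtain ⟨hm, hsub, hvol⟩ := volume_bin m j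
  have heq : measureOfDensity a (bin m j) = ∫⁻ x in bin m j, ENNReal.ofReal (a x) := by
    rw [measureOfDensity, withDensity_apply _ hm, Measure.restrict_restrict hm,
      inter_eq_left.2 hsub]
  have hlo : ENNReal.ofReal (l / ((m : ℝ) + 1)) ≤ measureOfDensity a (bin m j) := by
    rw [heq, div_eq_mul_one_div, ENNReal.ofReal_mul hl0, ← hvol, ← setLIntegral_const]
    exact setLIntegral_mono' hm fun x hx => ENNReal.ofReal_le_ofReal (hl x (hsub hx))
  have hhi : measureOfDensity a (bin m j) ≤ ENNReal.ofReal (U / ((m : ℝ) + 1)) := by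
    rw [heq, div_eq_mul_one_div, ENNReal.ofReal_mul hU0, ← hvol, ← setLIntegral_const]
    exact setLIntegral_mono' hm fun x hx => ENNReal.ofReal_le_ofReal (hU x (hsub hx))
  refine ⟨?_, ENNReal.toReal_le_of_le_ofReal (by positivity) hhi⟩
  exact (ENNReal.ofReal_le_iff_le_toReal (ne_top_of_le_ne_top ENNReal.ofReal_ne_top hhi)).1 hlo

/-- Each coordinate contributes a shape at least `l/k` and an interval of length at least `(δ/k)
k⁻²`, whence `k⁻⁴` per bin and `exp(-O(k log k))` in all. The relative width `k⁻²` matches the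
approximation error of polygons. -/
lemma le_pi_gammaMeasure_Icc {m : ℕ} {a u : Fin (m + 1) → ℝ} {l δ : ℝ} (hl : 0 < l) (hδ : 0 < δ)
    (ha : ∀ i, l / ((m : ℝ) + 1) ≤ a i) (ha1 : ∀ i, a i ≤ 1)
    (hu : ∀ i, δ / ((m : ℝ) + 1) ≤ u i) (hu1 : ∀ i, u i ≤ 1) :
    ENNReal.ofReal ((l * δ * Real.exp (-2) / 2 / ((m : ℝ) + 1) ^ 4) ^ (m + 1))
      ≤ Measure.pi (fun i => gammaMeasure (a i) 1)
        (univ.pi fun i => Icc (u i) (u i * (1 + 1 / ((m : ℝ) + 1) ^ 2))) := by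
  have hk : (0 : ℝ) < (m : ℝ) + 1 := by positivity
  have hk1 : (1 : ℝ) ≤ (m : ℝ) + 1 := by linarith [(Nat.cast_nonneg m : (0 : ℝ) ≤ m)]
  have ha0 : ∀ i, 0 < a i := fun i => lt_of_lt_of_le (by positivity) (ha i)
  have hu0 : ∀ i, 0 < u i := fun i => lt_of_lt_of_le (by positivity) (hu i)
  have : ∀ i, IsProbabilityMeasure (gammaMeasure (a i) 1) := fun i =>
    isProbabilityMeasure_gammaMeasure (ha0 i) one_pos
  rw [Measure.pi_pi, ENNReal.ofReal_pow (by positivity)]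
  have : ∀ i ∈ (Finset.univ : Finset (Fin (m + 1))),
      ENNReal.ofReal (l * δ * Real.exp (-2) / 2 / ((m : ℝ) + 1) ^ 4)
      ≤ gammaMeasure (a i) 1 (Icc (u i) (u i * (1 + 1 / ((m : ℝ) + 1) ^ 2))) := by
    intro i _
    refine le_trans (ENNReal.ofReal_le_ofReal ?_) (le_gammaMeasure_Icc (ha0 i) (ha1 i) (hu0 i) ?_)
    · calc l * δ * Real.exp (-2) / 2 / ((m : ℝ) + 1) ^ 4
          = (l / ((m : ℝ) + 1)) * Real.exp (-2) / 2
            * ((δ / ((m : ℝ) + 1)) * (1 / ((m : ℝ) + 1) ^ 2)) := by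
            field_simp
        _ ≤ a i * Real.exp (-2) / 2 * (u i * (1 / ((m : ℝ) + 1) ^ 2)) := by
            have h1 := ha i
            have h2 := hu i
            have h3 := (ha0 i).le
            gcongr
        _ = _ := by ring
    · have h1 : 1 / ((m : ℝ) + 1) ^ 2 ≤ 1 := by
        rw [div_le_one (by positivity)]
        nlinarith
      have h2 := hu1 i
      nlinarith [hu0 i]
  have h := Finset.prod_le_prod' this
  rwa [Finset.prod_const, Finset.card_univ, Fintype.card_fin] at h

/-! ### The prior as a series of Gamma integrals, and means of likelihood ratios -/

lemma lintegral_pi_prod_eq_pow {E : Type*} [MeasurableSpace E] (μ : Measure E) [SigmaFinite μ]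
    {f : E → ENNReal} (hf : Measurable f) (n : ℕ) :
    ∫⁻ x : Fin n → E, ∏ i, f (x i) ∂(Measure.pi fun _ => μ) = (∫⁻ x, f x ∂μ) ^ n := by
  induction n with
  | zero => simp
  | succ n ih =>
    have hm : Measurable fun x : Fin n → E => ∏ i, f (x i) := by fun_prop
    have h := (measurePreserving_piFinSuccAbove (fun _ : Fin (n + 1) => μ) 0).symm
    rw [← h.lintegral_comp (by fun_prop)]
    simp_rw [MeasurableEquiv.piFinSuccAbove_symm_apply, Fin.insertNthEquiv,
      Fin.prod_univ_succ, Fin.insertNth_zero, Equiv.coe_fn_mk, Fin.cons_succ, Fin.cons_zero]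
    rw [pow_succ', ← ih]
    exact lintegral_prod_mul hf.aemeasurable hm.aemeasurable

lemma measurable_sigma {ι : Type*} {β : ι → Type*} [∀ i, MeasurableSpace (β i)]
    {γ : Type*} [MeasurableSpace γ] {F : (Σ i, β i) → γ}
    (h : ∀ i, Measurable fun b => F ⟨i, b⟩) : Measurable F := by
  intro s hs
  rw [Sigma.instMeasurableSpace, MeasurableSpace.measurableSet_iInf]
  exact fun i => h i hs

lemma measurable_sigma_mk' {ι : Type*} {β : ι → Type*} [∀ i, MeasurableSpace (β i)] (i : ι) :
    Measurable (Sigma.mk i : β i → Σ i, β i) := by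
  intro s hs
  rw [Sigma.instMeasurableSpace, MeasurableSpace.measurableSet_iInf] at hs
  exact hs i

/-- The vector of bin weights obtained from independent Gamma variables. -/
noncomputable def normalize {ι : Type*} [Fintype ι] (g : ι → ℝ) : ι → ℝ := fun i => g i / ∑ j, g j

lemma measurable_normalize {ι : Type*} [Fintype ι] :
    Measurable (normalize : (ι → ℝ) → ι → ℝ) := by
  unfold normalize
  fun_prop

/-- Integrals over the prior become integrals over independent Gamma variables, so the Dirichlet
density on the simplex never appears. -/
lemma lintegral_polygonPrior (ρ : ℕ → ℝ) (α : Measure ℝ) {F : Param → ENNReal}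
    (hF : Measurable F) :
    ∫⁻ θ, F θ ∂polygonPrior ρ α = ∑' m : ℕ, ENNReal.ofReal (ρ (m + 1)) *
      ∫⁻ g, F ⟨m, normalize g⟩
        ∂Measure.pi (fun j : Fin (m + 1) => gammaMeasure ((α (bin m j)).toReal) 1) := by
  rw [polygonPrior, lintegral_sum_measure]
  congr 1
  ext m
  rw [lintegral_smul_measure, lintegral_map hF (measurable_sigma_mk' m), smul_eq_mul]
  congr 1
  exact lintegral_map (hF.comp (measurable_sigma_mk' m)) measurable_normalize

/-- The likelihood ratio. -/
noncomputable def lik (f : ℝ → ℝ) {n : ℕ} (θ : Param) (X : Fin n → ℝ) : ENNReal :=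
  ∏ i, ENNReal.ofReal (density θ (X i) / f (X i))

/-- The inverse of the likelihood ratio. -/
noncomputable def likInv (f : ℝ → ℝ) {n : ℕ} (θ : Param) (X : Fin n → ℝ) : ENNReal :=
  ∏ i, ENNReal.ofReal (f (X i) / density θ (X i))

lemma measurable_lik {f : ℝ → ℝ} {n : ℕ} (X : Fin n → ℝ) :
    Measurable fun θ => lik f θ X := by
  refine measurable_sigma fun m => Finset.measurable_prod _ fun i _ => ?_
  exact (((measurable_polygon m).comp (measurable_id.prodMk measurable_const)).div_const
    _).ennreal_ofReal

lemma measurable_density_prod {n m : ℕ} (i : Fin n) :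
    Measurable fun p : (Fin n → ℝ) × (Fin (m + 1) → ℝ) =>
      density ⟨m, normalize p.2⟩ (p.1 i) :=
  (measurable_polygon m).comp ((measurable_normalize.comp measurable_snd).prodMk
    ((measurable_pi_apply i).comp measurable_fst))

lemma measurable_lik_prod {f : ℝ → ℝ} (hf : Measurable f) {n m : ℕ} :
    Measurable fun p : (Fin n → ℝ) × (Fin (m + 1) → ℝ) => lik f ⟨m, normalize p.2⟩ p.1 :=
  Finset.measurable_prod _ fun i _ => ((measurable_density_prod i).div
    (hf.comp ((measurable_pi_apply i).comp measurable_fst))).ennreal_ofReal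

lemma measurable_likInv_prod {f : ℝ → ℝ} (hf : Measurable f) {n m : ℕ} :
    Measurable fun p : (Fin n → ℝ) × (Fin (m + 1) → ℝ) => likInv f ⟨m, normalize p.2⟩ p.1 :=
  Finset.measurable_prod _ fun i _ => ((hf.comp ((measurable_pi_apply i).comp
    measurable_fst)).div (measurable_density_prod i)).ennreal_ofReal

lemma lintegral_measureOfDensity {f : ℝ → ℝ} (hf : Measurable f) {g : ℝ → ENNReal}
    (hg : Measurable g) :
    ∫⁻ x, g x ∂measureOfDensity f = ∫⁻ x in Icc (0 : ℝ) 1, ENNReal.ofReal (f x) * g x := by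
  rw [measureOfDensity, lintegral_withDensity_eq_lintegral_mul _ hf.ennreal_ofReal hg]
  rfl

lemma isProbabilityMeasure_measureOfDensity {f : ℝ → ℝ} (hi : IntegrableOn f (Icc 0 1))
    (h0 : ∀ x ∈ Icc (0 : ℝ) 1, 0 ≤ f x) (h1 : ∫ x in Icc (0 : ℝ) 1, f x = 1) :
    IsProbabilityMeasure (measureOfDensity f) := by
  refine ⟨?_⟩
  rw [measureOfDensity, withDensity_apply _ MeasurableSet.univ, Measure.restrict_univ,
    ← ofReal_integral_eq_lintegral_ofReal hi, h1, ENNReal.ofReal_one]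
  filter_upwards [ae_restrict_mem measurableSet_Icc] with x hx using h0 x hx

lemma measurable_density (θ : Param) : Measurable (density θ) :=
  (measurable_polygon θ.1).comp (measurable_const.prodMk measurable_id)

/-- The factor `f` cancels, so each observation contributes the total mass of the polygon. An
inequality for the sum of the weights allows for normalization by a zero sum. -/
lemma lintegral_lik_le_one {f : ℝ → ℝ} (hf : Measurable f) [SigmaFinite (measureOfDensity f)]
    (hpos : ∀ x ∈ Icc (0 : ℝ) 1, 0 < f x) {m n : ℕ} {w : Fin (m + 1) → ℝ} (hw : ∀ i, 0 ≤ w i)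
    (hw1 : ∑ i, w i ≤ 1) :
    ∫⁻ X : Fin n → ℝ, lik f ⟨m, w⟩ X ∂(Measure.pi fun _ => measureOfDensity f) ≤ 1 := by
  have hm : Measurable fun x => ENNReal.ofReal (density ⟨m, w⟩ x / f x) :=
    ((measurable_density _).div hf).ennreal_ofReal
  simp only [lik]
  rw [lintegral_pi_prod_eq_pow _ hm]
  refine pow_le_one' ?_ n
  rw [lintegral_measureOfDensity hf hm]
  calc ∫⁻ x in Icc (0 : ℝ) 1, ENNReal.ofReal (f x) * ENNReal.ofReal (density ⟨m, w⟩ x / f x)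
      = ∫⁻ x in Icc (0 : ℝ) 1, ENNReal.ofReal (polygon m w x) := by
        refine setLIntegral_congr_fun measurableSet_Icc fun x hx => ?_
        have := hpos x hx
        simp only [density]
        rw [← ENNReal.ofReal_mul this.le, mul_div_cancel₀ _ this.ne']
    _ = ENNReal.ofReal (∑ i, w i) := by
        rw [← setIntegral_polygon,
          ofReal_integral_eq_lintegral_ofReal (integrable_polygon m w).integrableOn]
        exact Eventually.of_forall fun x => polygon_nonneg hw x
    _ ≤ 1 := by rw [← ENNReal.ofReal_one]; exact ENNReal.ofReal_le_ofReal hw1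

/-- Under `f` the mean of `f / p` is the integral of `f² / p`, and independence raises it to the
power `n`. -/
lemma lintegral_likInv_le {f : ℝ → ℝ} (hf : Measurable f) [SigmaFinite (measureOfDensity f)]
    {δ e : ℝ} (hδ0 : 0 < δ) (hδ : ∀ x ∈ Icc (0 : ℝ) 1, δ ≤ f x)
    (hfi : IntegrableOn f (Icc 0 1)) (hf1 : ∫ x in Icc (0 : ℝ) 1, f x = 1)
    {m n : ℕ} {w : Fin (m + 1) → ℝ} (hw1 : ∑ i, w i = 1)
    (he : ∀ x ∈ Icc (0 : ℝ) 1, |polygon m w x - f x| ≤ e) (heδ : e ≤ δ / 2) :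
    ∫⁻ X : Fin n → ℝ, likInv f ⟨m, w⟩ X ∂(Measure.pi fun _ => measureOfDensity f)
      ≤ ENNReal.ofReal (Real.exp (n * (2 * e ^ 2 / δ))) := by
  have hm : Measurable fun x => ENNReal.ofReal (f x / density ⟨m, w⟩ x) :=
    (hf.div (measurable_density _)).ennreal_ofReal
  simp only [likInv]
  rw [lintegral_pi_prod_eq_pow _ hm, Real.exp_nat_mul, ENNReal.ofReal_pow (Real.exp_pos _).le]
  refine pow_le_pow_left' ?_ n
  rw [lintegral_measureOfDensity hf hm]
  refine le_trans (le_of_eq ?_) (lintegral_sq_div_le hδ0 hfi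
    (integrable_polygon m w).integrableOn hf1 ((setIntegral_polygon m w).trans hw1) hδ he heδ)
  refine setLIntegral_congr_fun measurableSet_Icc fun x hx => ?_
  simp only [density]
  rw [← ENNReal.ofReal_mul (hδ0.trans_le (hδ x hx)).le]
  congr 1
  ring

/-! ### Lower bound for the evidence and bound for the posterior -/

lemma two_le_mul_add {t A B : ENNReal} (ht0 : t ≠ 0) (ht : t ≠ ⊤) {x : ℝ} (hx : 0 < x)
    (hA : A = ENNReal.ofReal x) (hB : B = ENNReal.ofReal x⁻¹) : 2 ≤ t * A + t⁻¹ * B := by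
  obtain ⟨s, rfl⟩ : ∃ s : ℝ, t = ENNReal.ofReal s := ⟨t.toReal, (ENNReal.ofReal_toReal ht).symm⟩
  have hs : 0 < s := by simpa using ht0
  rw [hA, hB, ← ENNReal.ofReal_inv_of_pos hs, ← ENNReal.ofReal_mul hs.le,
    ← ENNReal.ofReal_mul (by positivity), ← ENNReal.ofReal_add (by positivity) (by positivity),
    show (2 : ENNReal) = ENNReal.ofReal 2 by simp, ← mul_inv]
  apply ENNReal.ofReal_le_ofReal
  have hy : 0 < s * x := by positivity
  have : s * x + (s * x)⁻¹ - 2 = (s * x - 1) ^ 2 / (s * x) := by field_simp; ring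
  have h2 : 0 ≤ (s * x - 1) ^ 2 / (s * x) := by positivity
  linarith

/-- A lower bound for the evidence by means of the mean of the inverse likelihood ratio. -/
lemma two_le_lik_add_likInv {f : ℝ → ℝ} {n : ℕ} {θ : Param} {X : Fin n → ℝ}
    (hf : ∀ i, 0 < f (X i)) (hθ : ∀ i, 0 < density θ (X i)) {t : ENNReal} (ht0 : t ≠ 0)
    (ht : t ≠ ⊤) : 2 ≤ t * lik f θ X + t⁻¹ * likInv f θ X := by
  refine two_le_mul_add ht0 ht (x := ∏ i, density θ (X i) / f (X i))
    (Finset.prod_pos fun i _ => div_pos (hθ i) (hf i)) ?_ ?_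
  · rw [lik, ENNReal.ofReal_prod_of_nonneg fun i _ => (div_pos (hθ i) (hf i)).le]
  · rw [likInv, ← Finset.prod_inv_distrib,
      ENNReal.ofReal_prod_of_nonneg fun i _ => (inv_pos.2 (div_pos (hθ i) (hf i))).le]
    simp_rw [inv_div]

/-- Off the event `J ≥ t v` the term `t⁻¹ J` absorbs one of the two copies of `v`, which leaves `D ≥
r v / t`; a large ratio then makes `N` large. Markov's inequality for `J` and for `N` gives the two
summands. -/
lemma measure_ratio_gt_le {Ω : Type*} [MeasurableSpace Ω] (Q : Measure Ω) {N D D' J : Ω → ENNReal}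
    (hN : AEMeasurable N Q) (hJ : AEMeasurable J Q) {v r t b η : ENNReal}
    (hv0 : v ≠ 0) (hv : v ≠ ⊤) (ht0 : t ≠ 0) (ht : t ≠ ⊤) (hr0 : r ≠ 0) (hr : r ≠ ⊤)
    (hη0 : η ≠ 0) (hη : η ≠ ⊤)
    (hpt : ∀ᵐ x ∂Q, 2 * v ≤ t * D' x + t⁻¹ * J x) (hD : ∀ x, r * D' x ≤ D x)
    (hEJ : ∫⁻ x, J x ∂Q ≤ b * v) :
    Q {x | η < N x / D x} ≤ b / t + (∫⁻ x, N x ∂Q) * t / (η * r * v) := by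
  have hsub : ({x | η < N x / D x} : Set Ω) ≤ᵐ[Q]
      ({x | t * v ≤ J x} ∪ {x | η * (r * (v / t)) ≤ N x} : Set Ω) := by
    filter_upwards [hpt] with x hx hbad
    by_cases hJx : t * v ≤ J x
    · exact Or.inl hJx
    · right
      push Not at hJx
      have h1 : t⁻¹ * J x ≤ v := by
        calc t⁻¹ * J x ≤ t⁻¹ * (t * v) := by gcongr
          _ = v := by rw [← mul_assoc, ENNReal.inv_mul_cancel ht0 ht, one_mul]
      have h2 : v + v ≤ t * D' x + v := by
        rw [← two_mul]
        exact hx.trans (by gcongr)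
      have h3 : v ≤ t * D' x := (ENNReal.add_le_add_iff_right hv).1 h2
      have h4 : v / t ≤ D' x := ENNReal.div_le_of_le_mul' h3
      have h5 : η * D x < N x := ENNReal.mul_lt_of_lt_div hbad
      change η * (r * (v / t)) ≤ N x
      calc η * (r * (v / t)) ≤ η * D x := by
            gcongr
            exact (by gcongr : r * (v / t) ≤ r * D' x).trans (hD x)
        _ ≤ N x := h5.le
  refine (measure_mono_ae hsub).trans ((measure_union_le _ _).trans (add_le_add ?_ ?_))
  · refine (meas_ge_le_lintegral_div hJ (mul_ne_zero ht0 hv0) (ENNReal.mul_ne_top ht hv)).trans ?_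
    refine (ENNReal.div_le_div_right hEJ _).trans (le_of_eq ?_)
    rw [ENNReal.mul_div_mul_right _ _ hv0 hv]
  · have hvt0 : v / t ≠ 0 := by simp [hv0, ht]
    have hvt : v / t ≠ ⊤ := ENNReal.div_ne_top hv ht0
    refine (meas_ge_le_lintegral_div hN (mul_ne_zero hη0 (mul_ne_zero hr0 hvt0))
      (ENNReal.mul_ne_top hη (ENNReal.mul_ne_top hr hvt))).trans (le_of_eq ?_)
    rw [show η * (r * (v / t)) = (η * r * v) / t by rw [← mul_assoc, mul_div_assoc]]
    have h0 : η * r * v ≠ 0 := mul_ne_zero (mul_ne_zero hη0 hr0) hv0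
    rw [ENNReal.div_eq_inv_mul, ENNReal.inv_div (Or.inl ht) (Or.inl ht0), ENNReal.div_eq_inv_mul,
      ENNReal.div_eq_inv_mul]
    ring

lemma ae_mem_Icc_pi {f : ℝ → ℝ} [IsProbabilityMeasure (measureOfDensity f)] (n : ℕ) :
    ∀ᵐ X : Fin n → ℝ ∂(Measure.pi fun _ => measureOfDensity f), ∀ i, X i ∈ Icc (0 : ℝ) 1 := by
  rw [ae_all_iff]
  intro i
  have h : ∀ᵐ x ∂measureOfDensity f, x ∈ Icc (0 : ℝ) 1 :=
    (withDensity_absolutelyContinuous _ _).ae_le (ae_restrict_mem measurableSet_Icc)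
  exact (Measure.quasiMeasurePreserving_eval (fun _ : Fin n => measureOfDensity f) i).ae h

/-- Enlarging `B` to all parameters whose number of bins is allowed gives a measurable set and an
integral that splits over `m`; nothing is assumed about the measurability of `B`. -/
lemma setLIntegral_lik_le {f : ℝ → ℝ} (ρ : ℕ → ℝ) (α : Measure ℝ) {P : Set ℕ} {B : Set Param}
    (hB : ∀ θ ∈ B, θ.1 ∈ P) {n : ℕ} (X : Fin n → ℝ) :
    ∫⁻ θ in B, lik f θ X ∂polygonPrior ρ α ≤
      ∑' m : ℕ, P.indicator (fun m => ENNReal.ofReal (ρ (m + 1))) m *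
        ∫⁻ g, lik f ⟨m, normalize g⟩ X
          ∂Measure.pi (fun j : Fin (m + 1) => gammaMeasure ((α (bin m j)).toReal) 1) := by
  have hmeas : MeasurableSet {θ : Param | θ.1 ∈ P} := by
    have : Measurable fun θ : Param => θ.1 := measurable_sigma fun m => measurable_const
    exact this (MeasurableSpace.measurableSet_top (s := P))
  calc ∫⁻ θ in B, lik f θ X ∂polygonPrior ρ α
      ≤ ∫⁻ θ in {θ : Param | θ.1 ∈ P}, lik f θ X ∂polygonPrior ρ α := lintegral_mono_set hB
    _ = ∫⁻ θ, {θ : Param | θ.1 ∈ P}.indicator (fun θ => lik f θ X) θ ∂polygonPrior ρ α :=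
        (lintegral_indicator hmeas _).symm
    _ = _ := by
        rw [lintegral_polygonPrior ρ α ((measurable_lik X).indicator hmeas)]
        congr 1
        ext m
        by_cases h : m ∈ P
        · rw [indicator_of_mem h]
          congr 1
          refine lintegral_congr fun g => ?_
          exact indicator_of_mem (s := {θ : Param | θ.1 ∈ P}) h _
        · rw [indicator_of_notMem h, zero_mul]
          have : ∀ g : Fin (m + 1) → ℝ, {θ : Param | θ.1 ∈ P}.indicator (fun θ => lik f θ X)
              ⟨m, normalize g⟩ = 0 := fun g =>
            indicator_of_notMem (s := {θ : Param | θ.1 ∈ P}) h _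
          simp [this]

lemma sum_normalize_le_one {ι : Type*} [Fintype ι] (g : ι → ℝ) : ∑ i, normalize g i ≤ 1 := by
  simp only [normalize]
  rw [← Finset.sum_div]
  exact div_self_le_one _

lemma lintegral_lintegral_lik_le_one {f : ℝ → ℝ} (hf : Measurable f)
    [IsProbabilityMeasure (measureOfDensity f)]
    (hpos : ∀ x ∈ Icc (0 : ℝ) 1, 0 < f x) {m n : ℕ} {a : Fin (m + 1) → ℝ} (ha : ∀ i, 0 < a i) :
    ∫⁻ X : Fin n → ℝ, ∫⁻ g, lik f ⟨m, normalize g⟩ X ∂Measure.pi (fun j => gammaMeasure (a j) 1)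
      ∂(Measure.pi fun _ => measureOfDensity f) ≤ 1 := by
  have : ∀ i, IsProbabilityMeasure (gammaMeasure (a i) 1) := fun i =>
    isProbabilityMeasure_gammaMeasure (ha i) one_pos
  rw [lintegral_lintegral_swap (measurable_lik_prod hf).aemeasurable]
  have hnn : ∀ᵐ g ∂Measure.pi (fun j => gammaMeasure (a j) 1), ∀ i, 0 ≤ g i := by
    rw [ae_all_iff]
    intro i
    exact (Measure.quasiMeasurePreserving_eval (fun j => gammaMeasure (a j) 1) i).ae
      (ae_gammaMeasure_nonneg (a i))
  calc _ ≤ ∫⁻ _ : Fin (m + 1) → ℝ, 1 ∂Measure.pi (fun j => gammaMeasure (a j) 1) := by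
        refine lintegral_mono_ae ?_
        filter_upwards [hnn] with g hg
        exact lintegral_lik_le_one hf hpos
          (fun i => div_nonneg (hg i) (Finset.sum_nonneg fun j _ => hg j)) (sum_normalize_le_one g)
    _ = 1 := by simp

/-- Weights close to the bin integrals of `f` give polygons which are close to `f`. -/
lemma abs_polygon_normalize_sub_le {f f' : ℝ → ℝ} (hfc : ContinuousOn f (Icc 0 1))
    (hf1 : ∫ x in Icc (0 : ℝ) 1, f x = 1) {U M : ℝ} (hpos : ∀ x ∈ Icc (0 : ℝ) 1, 0 ≤ f x)
    (hU : ∀ x ∈ Icc (0 : ℝ) 1, f x ≤ U) (hM0 : 0 < M)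
    (hM : ∀ x ∈ Icc (0 : ℝ) 1, ∀ y ∈ Icc (0 : ℝ) 1,
      |f y - f x - f' x * (y - x)| ≤ M * (y - x) ^ 2)
    (h0 : f' 0 = 0) (h1 : f' 1 = 0) {m : ℕ} {g : Fin (m + 1) → ℝ}
    (hg : ∀ i, g i ∈ Icc (binIntegral f m i)
      (binIntegral f m i * (1 + 1 / ((m : ℝ) + 1) ^ 2))) :
    ∑ i, normalize g i = 1 ∧ ∀ x ∈ Icc (0 : ℝ) 1,
      |polygon m (normalize g) x - f x| ≤ (U + 3 * M) / ((m : ℝ) + 1) ^ 2 := by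
  have hk : (0 : ℝ) < (m : ℝ) + 1 := by positivity
  have hub := fun j => const_mul_le_binIntegral hfc hpos hU m j
  have hu0 : ∀ j, 0 ≤ binIntegral f m j := fun j => by simpa using (hub j).1
  have husum : ∑ j, binIntegral f m j = 1 := (sum_binIntegral hfc m).trans hf1
  constructor
  · simp only [normalize]
    rw [← Finset.sum_div, div_self]
    have : 1 ≤ ∑ j, g j := husum ▸ Finset.sum_le_sum fun i _ => (hg i).1
    linarith
  · intro x hx
    have hw : ∀ i, |normalize g i * ((m : ℝ) + 1) - f (mid m i)|
        ≤ (U + M) / ((m : ℝ) + 1) ^ 2 := by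
      intro i
      have e1 := abs_div_sum_sub_le hu0 husum hg i
      have e2 := abs_binIntegral_sub_le hM0 hfc hM m i
      have e3 : |(normalize g i - binIntegral f m i) * ((m : ℝ) + 1)|
          ≤ U / ((m : ℝ) + 1) ^ 2 := by
        rw [abs_mul, abs_of_pos hk]
        calc |normalize g i - binIntegral f m i| * ((m : ℝ) + 1)
            ≤ binIntegral f m i * (1 / ((m : ℝ) + 1) ^ 2) * ((m : ℝ) + 1) :=
              mul_le_mul_of_nonneg_right e1 hk.le
          _ ≤ U / ((m : ℝ) + 1) * (1 / ((m : ℝ) + 1) ^ 2) * ((m : ℝ) + 1) := by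
              have := (hub i).2
              gcongr
          _ = _ := by field_simp
      calc |normalize g i * ((m : ℝ) + 1) - f (mid m i)|
          = |(normalize g i - binIntegral f m i) * ((m : ℝ) + 1)
            + (binIntegral f m i * ((m : ℝ) + 1) - f (mid m i))| := by
            congr 1; ring
        _ ≤ U / ((m : ℝ) + 1) ^ 2 + M / ((m : ℝ) + 1) ^ 2 :=
            (abs_add_le _ _).trans (add_le_add e3 e2)
        _ = _ := by ring
    refine (abs_polygon_sub_le hM0 hM h0 h1 hw hx).trans (le_of_eq ?_)
    ring

/-- The pointwise bound `2 ≤ t L + t⁻¹ L⁻¹` is integrated over `V`. It plays the role of Jensen's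
inequality in the usual evidence bound, with no logarithms. -/
lemma two_mul_measure_le {f : ℝ → ℝ} (hf : Measurable f) {m n : ℕ}
    (μ : Measure (Fin (m + 1) → ℝ)) {V : Set (Fin (m + 1) → ℝ)} (hV : MeasurableSet V)
    {X : Fin n → ℝ} (hX : ∀ i, 0 < f (X i))
    (hd : ∀ g ∈ V, ∀ i, 0 < density ⟨m, normalize g⟩ (X i)) {t : ENNReal} (ht0 : t ≠ 0)
    (ht : t ≠ ⊤) :
    2 * μ V ≤ t * ∫⁻ g in V, lik f ⟨m, normalize g⟩ X ∂μ
      + t⁻¹ * ∫⁻ g in V, likInv f ⟨m, normalize g⟩ X ∂μ := by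
  have m1 : Measurable fun g : Fin (m + 1) → ℝ => lik f ⟨m, normalize g⟩ X := by
    have h := (measurable_lik_prod (n := n) (m := m) hf).comp
      (measurable_prodMk_left (x := X))
    exact h
  have m2 : Measurable fun g : Fin (m + 1) → ℝ => likInv f ⟨m, normalize g⟩ X := by
    have h := (measurable_likInv_prod (n := n) (m := m) hf).comp
      (measurable_prodMk_left (x := X))
    exact h
  calc 2 * μ V = ∫⁻ _ in V, 2 ∂μ := (setLIntegral_const _ _).symm
    _ ≤ ∫⁻ g in V, (t * lik f ⟨m, normalize g⟩ X + t⁻¹ * likInv f ⟨m, normalize g⟩ X) ∂μ :=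
        setLIntegral_mono' hV fun g hg => two_le_lik_add_likInv hX (hd g hg) ht0 ht
    _ = _ := by
        rw [lintegral_add_left (m1.const_mul _), lintegral_const_mul _ m1,
          lintegral_const_mul _ m2]

lemma lintegral_setLIntegral_likInv_le {f : ℝ → ℝ} (hf : Measurable f) {m n : ℕ}
    (Q : Measure (Fin n → ℝ)) [SFinite Q] (μ : Measure (Fin (m + 1) → ℝ)) [SFinite μ]
    {V : Set (Fin (m + 1) → ℝ)} (hV : MeasurableSet V) {b : ENNReal}
    (hb : ∀ g ∈ V, ∫⁻ X, likInv f ⟨m, normalize g⟩ X ∂Q ≤ b) :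
    ∫⁻ X, ∫⁻ g in V, likInv f ⟨m, normalize g⟩ X ∂μ ∂Q ≤ b * μ V := by
  rw [lintegral_lintegral_swap (measurable_likInv_prod hf).aemeasurable, ← setLIntegral_const]
  exact setLIntegral_mono' hV hb

/-- The evidence is bounded below by the part of the prior with exactly `m + 1` bins and weights
close to the bin integrals of `f`. The first term bounds the probability that the evidence falls
short, at a level set by `exp s`; the second is Markov's inequality for the numerator, whose mean is
at most the prior mass of `P`. -/
theorem measure_posterior_gt_le {f f' : ℝ → ℝ} (hf : Measurable f)
    (hfc : ContinuousOn f (Icc 0 1)) (hf1 : ∫ x in Icc (0 : ℝ) 1, f x = 1) {δ U M : ℝ}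
    (hδ0 : 0 < δ) (hδ : ∀ x ∈ Icc (0 : ℝ) 1, δ ≤ f x) (hU : ∀ x ∈ Icc (0 : ℝ) 1, f x ≤ U)
    (hM0 : 0 < M)
    (hM : ∀ x ∈ Icc (0 : ℝ) 1, ∀ y ∈ Icc (0 : ℝ) 1,
      |f y - f x - f' x * (y - x)| ≤ M * (y - x) ^ 2)
    (h0 : f' 0 = 0) (h1 : f' 1 = 0) {ρ : ℕ → ℝ} {a : ℝ → ℝ} {l A : ℝ} (hl0 : 0 < l)
    (hA0 : 0 < A) (hl : ∀ x ∈ Icc (0 : ℝ) 1, l ≤ a x) (hA : ∀ x ∈ Icc (0 : ℝ) 1, a x ≤ A)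
    {P : Set ℕ} {B : Set Param} (hB : ∀ θ ∈ B, θ.1 ∈ P) {m : ℕ} (n : ℕ) (hρ : 0 < ρ (m + 1))
    (hmδ : (U + 3 * M) / ((m : ℝ) + 1) ^ 2 ≤ δ / 2) (hmA : A / ((m : ℝ) + 1) ≤ 1)
    {η : ℝ} (hη : 0 < η) (s : ℝ) :
    Measure.pi (fun _ : Fin n => measureOfDensity f)
        {X | ENNReal.ofReal η < posterior (polygonPrior ρ (measureOfDensity a)) f X B}
      ≤ ENNReal.ofReal (Real.exp
          (n * (2 * ((U + 3 * M) / ((m : ℝ) + 1) ^ 2) ^ 2 / δ))) / ENNReal.ofReal (Real.exp s)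
        + (∑' m : ℕ, P.indicator (fun m => ENNReal.ofReal (ρ (m + 1))) m)
          * ENNReal.ofReal (Real.exp s)
          / (ENNReal.ofReal η * ENNReal.ofReal (ρ (m + 1))
            * ENNReal.ofReal ((l * δ * Real.exp (-2) / 2 / ((m : ℝ) + 1) ^ 4) ^ (m + 1))) := by
  have hk : (0 : ℝ) < (m : ℝ) + 1 := by positivity
  have hfi : IntegrableOn f (Icc 0 1) := hfc.integrableOn_Icc
  have hpos : ∀ x ∈ Icc (0 : ℝ) 1, 0 < f x := fun x hx => hδ0.trans_le (hδ x hx)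
  have hprob := isProbabilityMeasure_measureOfDensity hfi (fun x hx => (hpos x hx).le) hf1
  set α := measureOfDensity a with hα
  have hbin : ∀ (m : ℕ) (j : Fin (m + 1)), l / ((m : ℝ) + 1) ≤ (α (bin m j)).toReal ∧
      (α (bin m j)).toReal ≤ A / ((m : ℝ) + 1) := fun m j =>
    measureOfDensity_bin hl0.le hA0.le hl hA m j
  have hbin0 : ∀ (m : ℕ) (j : Fin (m + 1)), 0 < (α (bin m j)).toReal := fun m j =>
    lt_of_lt_of_le (by positivity) (hbin m j).1
  have hgp : ∀ (m : ℕ) (j : Fin (m + 1)), IsProbabilityMeasure (gammaMeasure ((α (bin m j)).toReal) 1) := fun m j =>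
    isProbabilityMeasure_gammaMeasure (hbin0 m j) one_pos
  set μ : ∀ m : ℕ, Measure (Fin (m + 1) → ℝ) := fun m =>
    Measure.pi fun j => gammaMeasure ((α (bin m j)).toReal) 1 with hμ
  have hμp : ∀ m, IsProbabilityMeasure (μ m) := fun m => by rw [hμ]; infer_instance
  set V : Set (Fin (m + 1) → ℝ) := univ.pi fun i =>
    Icc (binIntegral f m i) (binIntegral f m i * (1 + 1 / ((m : ℝ) + 1) ^ 2)) with hV
  have hVm : MeasurableSet V := MeasurableSet.univ_pi fun i => measurableSet_Icc
  have hub := fun j => const_mul_le_binIntegral hfc hδ hU m j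
  have hu0 : ∀ j, 0 < binIntegral f m j := fun j => lt_of_lt_of_le (by positivity) (hub j).1
  have hu1 : ∀ j, binIntegral f m j ≤ 1 := fun j => ((sum_binIntegral hfc m).trans hf1) ▸
    Finset.single_le_sum (fun i _ => (hu0 i).le) (Finset.mem_univ j)
  have hvlow : ENNReal.ofReal ((l * δ * Real.exp (-2) / 2 / ((m : ℝ) + 1) ^ 4) ^ (m + 1))
      ≤ μ m V :=
    le_pi_gammaMeasure_Icc hl0 hδ0 (fun i => (hbin m i).1) (fun i => (hbin m i).2.trans hmA)
      (fun i => (hub i).1) hu1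
  have hvpos : (0 : ENNReal)
      < ENNReal.ofReal ((l * δ * Real.exp (-2) / 2 / ((m : ℝ) + 1) ^ 4) ^ (m + 1)) := by
    rw [ENNReal.ofReal_pos]
    positivity
  have hnear : ∀ g ∈ V, ∑ i, normalize g i = 1 ∧ ∀ x ∈ Icc (0 : ℝ) 1,
      |polygon m (normalize g) x - f x| ≤ (U + 3 * M) / ((m : ℝ) + 1) ^ 2 := fun g hg =>
    abs_polygon_normalize_sub_le hfc hf1 (fun x hx => (hpos x hx).le) hU hM0 hM h0 h1
      fun i => hg i (mem_univ i)
  clear_value V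
  have hinner : ∀ m, Measurable fun X : Fin n → ℝ => ∫⁻ g, lik f ⟨m, normalize g⟩ X ∂μ m :=
    fun m => (measurable_lik_prod hf).lintegral_prod_right'
  have ht0 : ENNReal.ofReal (Real.exp s) ≠ 0 := by simp [Real.exp_pos]
  -- By Tonelli, each likelihood integral has mean at most one, so only the prior probabilities of
  -- the models in `P` remain.
  have hEN : ∫⁻ X, (∑' m : ℕ, P.indicator (fun m => ENNReal.ofReal (ρ (m + 1))) m *
      ∫⁻ g, lik f ⟨m, normalize g⟩ X ∂μ m) ∂(Measure.pi fun _ : Fin n => measureOfDensity f)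
      ≤ ∑' m : ℕ, P.indicator (fun m => ENNReal.ofReal (ρ (m + 1))) m := by
    rw [lintegral_tsum fun m => ((hinner m).const_mul _).aemeasurable]
    refine ENNReal.tsum_le_tsum fun m => ?_
    rw [lintegral_const_mul _ (hinner m)]
    exact mul_le_of_le_one_right' (lintegral_lintegral_lik_le_one hf hpos (hbin0 m))
  have hpt : ∀ᵐ X ∂(Measure.pi fun _ : Fin n => measureOfDensity f),
      2 * μ m V ≤ ENNReal.ofReal (Real.exp s) * ∫⁻ g in V, lik f ⟨m, normalize g⟩ X ∂μ m
      + (ENNReal.ofReal (Real.exp s))⁻¹ * ∫⁻ g in V, likInv f ⟨m, normalize g⟩ X ∂μ m := by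
    filter_upwards [ae_mem_Icc_pi (f := f) n] with X hX
    refine two_mul_measure_le hf (μ m) hVm (fun i => hpos _ (hX i)) (fun g hg i => ?_) ht0
      ENNReal.ofReal_ne_top
    have e1 := abs_le.1 ((hnear g hg).2 _ (hX i))
    have e2 := hδ _ (hX i)
    change 0 < polygon m (normalize g) (X i)
    linarith [e1.1]
  have hDD : ∀ X : Fin n → ℝ, ENNReal.ofReal (ρ (m + 1))
      * ∫⁻ g in V, lik f ⟨m, normalize g⟩ X ∂μ m ≤ ∫⁻ θ, lik f θ X ∂polygonPrior ρ α := by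
    intro X
    rw [lintegral_polygonPrior ρ α (measurable_lik X)]
    refine le_trans ?_ (ENNReal.le_tsum m)
    exact mul_le_mul_right (setLIntegral_le_lintegral _ _) _
  have hNm : Measurable fun X : Fin n → ℝ =>
      ∑' m : ℕ, P.indicator (fun m => ENNReal.ofReal (ρ (m + 1))) m *
        ∫⁻ g, lik f ⟨m, normalize g⟩ X ∂μ m :=
    Measurable.tsum (L := SummationFilter.unconditional ℕ) fun m => (hinner m).const_mul _
  have hmain := measure_ratio_gt_le (Measure.pi fun _ : Fin n => measureOfDensity f)
    (r := ENNReal.ofReal (ρ (m + 1))) (η := ENNReal.ofReal η)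
    hNm.aemeasurable
    (measurable_likInv_prod hf).lintegral_prod_right'.aemeasurable
    (hvpos.trans_le hvlow).ne' (measure_ne_top _ _) ht0 ENNReal.ofReal_ne_top (by simpa using hρ)
    ENNReal.ofReal_ne_top (by simpa using hη) ENNReal.ofReal_ne_top hpt hDD
    (lintegral_setLIntegral_likInv_le hf _ (μ m) hVm fun g hg =>
      lintegral_likInv_le hf hδ0 hδ hfi hf1 (hnear g hg).1 (hnear g hg).2 hmδ)
  refine (measure_mono fun X hX => ?_).trans (hmain.trans ?_)
  · refine lt_of_lt_of_le (mem_ofPred_eq ▸ hX) ?_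
    exact ENNReal.div_le_div_right (setLIntegral_lik_le ρ α hB X) _
  · gcongr

/-! ### Prior tails and the choice of the number of bins -/

/-- From `k log k ≥ k - 1` the prior decays geometrically; half of the rate yields the factor in
`K`, the other half sums the series. The lost logarithm does not matter, since the final comparison
is between different powers of `n`. -/
lemma exists_tail_bound {ρ : ℕ → ℝ} {B β : ℝ} (hB : 0 < B) (hβ : 0 < β)
    (hρ : ∀ k : ℕ, 1 ≤ k → ρ k ≤ B * Real.exp (-β * k * Real.log k)) :
    ∃ S > 0, ∀ K : ℝ,
      ∑' m : ℕ, {m : ℕ | K ≤ (m : ℝ) + 1}.indicator (fun m => ENNReal.ofReal (ρ (m + 1))) m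
        ≤ ENNReal.ofReal (S * Real.exp (-(β / 2) * K)) := by
  set r := Real.exp (-(β / 2)) with hr
  have hr0 : 0 < r := Real.exp_pos _
  have hr1 : r < 1 := Real.exp_lt_one_iff.2 (by linarith)
  have hr2 : 0 < 1 - r := sub_pos.2 hr1
  refine ⟨B * Real.exp (β / 2) * (1 - r)⁻¹, by positivity, fun K => ?_⟩
  have hterm : ∀ m : ℕ, {m : ℕ | K ≤ (m : ℝ) + 1}.indicator
      (fun m => ENNReal.ofReal (ρ (m + 1))) m
      ≤ ENNReal.ofReal (B * Real.exp (β / 2) * Real.exp (-(β / 2) * K) * r ^ m) := by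
    intro m
    by_cases hm : K ≤ (m : ℝ) + 1
    · rw [indicator_of_mem (show m ∈ {m : ℕ | K ≤ (m : ℝ) + 1} from hm)]
      apply ENNReal.ofReal_le_ofReal
      refine (hρ (m + 1) (by omega)).trans ?_
      have hk : (0 : ℝ) < (m : ℝ) + 1 := by positivity
      have hlog : (m : ℝ) ≤ ((m : ℝ) + 1) * Real.log ((m : ℝ) + 1) := by
        have := Real.one_sub_inv_le_log_of_pos hk
        calc (m : ℝ) = ((m : ℝ) + 1) * (1 - ((m : ℝ) + 1)⁻¹) := by field_simp; ring
          _ ≤ _ := mul_le_mul_of_nonneg_left this hk.le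
      rw [hr, ← Real.exp_nat_mul, mul_assoc B, mul_assoc B, ← Real.exp_add, ← Real.exp_add]
      refine mul_le_mul_of_nonneg_left (Real.exp_le_exp.2 ?_) hB.le
      push_cast
      have h1 := mul_le_mul_of_nonneg_left hlog hβ.le
      have h2 := mul_le_mul_of_nonneg_left hm hβ.le
      linarith
    · rw [indicator_of_notMem (show m ∉ {m : ℕ | K ≤ (m : ℝ) + 1} from hm)]
      exact zero_le
  refine (ENNReal.tsum_le_tsum hterm).trans (le_of_eq ?_)
  rw [← ENNReal.ofReal_tsum_of_nonneg (fun m => by positivity)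
    ((summable_geometric_of_lt_one hr0.le hr1).mul_left _), tsum_mul_left,
    tsum_geometric_of_lt_one hr0.le hr1]
  congr 1
  ring

/-- The number of bins, minus one, at sample size `n`. -/
noncomputable def binCount (n : ℕ) : ℕ := ⌊(n : ℝ) ^ (1 / 5 : ℝ)⌋₊

lemma tendsto_binCount : Tendsto (fun n => (binCount n : ℝ) + 1) atTop atTop := by
  have h1 : Tendsto (fun n : ℕ => (n : ℝ) ^ (1 / 5 : ℝ)) atTop atTop :=
    (tendsto_rpow_atTop (by norm_num)).comp tendsto_natCast_atTop_atTop
  refine tendsto_atTop_mono (fun n => ?_) h1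
  exact (Nat.lt_floor_add_one _).le

/-- This is what the exponent `1/5` is for: `n ≤ k⁵` makes the divergence term `n k⁻⁴` at most `k`.
-/
lemma le_binCount_pow (n : ℕ) : (n : ℝ) ≤ ((binCount n : ℝ) + 1) ^ 5 := by
  have h : (n : ℝ) ^ (1 / 5 : ℝ) ≤ (binCount n : ℝ) + 1 := (Nat.lt_floor_add_one _).le
  calc (n : ℝ) = ((n : ℝ) ^ (1 / 5 : ℝ)) ^ (5 : ℕ) := by
        rw [← Real.rpow_natCast, ← Real.rpow_mul (Nat.cast_nonneg n)]
        norm_num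
    _ ≤ _ := pow_le_pow_left₀ (by positivity) h 5

lemma binCount_le {n : ℕ} (hn : 1 ≤ n) : (binCount n : ℝ) + 1 ≤ 2 * (n : ℝ) ^ (1 / 5 : ℝ) := by
  have h1 : (binCount n : ℝ) ≤ (n : ℝ) ^ (1 / 5 : ℝ) := Nat.floor_le (by positivity)
  have h2 : (1 : ℝ) ≤ (n : ℝ) ^ (1 / 5 : ℝ) :=
    Real.one_le_rpow (by exact_mod_cast hn) (by norm_num)
  linarith

/-- The logarithm is absorbed by `log k ≤ 20 k^(1/20)`, so the positive terms are of order at most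
`n^(21/100)`. A power is left over, because `3/14 = 21/100 + 3/700`. -/
lemma tendsto_exponent {c : ℝ} (hc : 0 < c) (a b : ℝ) :
    Tendsto (fun n : ℕ => -c * (n : ℝ) ^ (3 / 14 : ℝ) + a * ((binCount n : ℝ) + 1)
      + b * (((binCount n : ℝ) + 1) * Real.log ((binCount n : ℝ) + 1))) atTop atBot := by
  set G : ℝ := (|a| + 20 * |b|) * 2 ^ (21 / 20 : ℝ) with hG
  have hlim : Tendsto (fun n : ℕ => (n : ℝ) ^ (21 / 100 : ℝ)
      * (G + -c * (n : ℝ) ^ (3 / 700 : ℝ))) atTop atBot := by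
    have h1 : Tendsto (fun n : ℕ => (n : ℝ) ^ (21 / 100 : ℝ)) atTop atTop :=
      (tendsto_rpow_atTop (by norm_num)).comp tendsto_natCast_atTop_atTop
    have h2 : Tendsto (fun n : ℕ => (n : ℝ) ^ (3 / 700 : ℝ)) atTop atTop :=
      (tendsto_rpow_atTop (by norm_num)).comp tendsto_natCast_atTop_atTop
    exact h1.atTop_mul_atBot₀ (tendsto_atBot_add_const_left _ _
      (h2.const_mul_atTop_of_neg (by linarith)))
  refine tendsto_atBot_mono' _ ?_ hlim
  filter_upwards [eventually_ge_atTop 1] with n hn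
  set k : ℝ := (binCount n : ℝ) + 1 with hk
  have hk1 : 1 ≤ k := by
    rw [hk]
    linarith [(Nat.cast_nonneg (binCount n) : (0 : ℝ) ≤ binCount n)]
  have hk0 : 0 < k := by linarith
  have hn0 : (0 : ℝ) < n := by exact_mod_cast hn
  set y := k ^ (21 / 20 : ℝ) with hy
  have e1 : k ≤ y := by
    calc k = k ^ (1 : ℝ) := (Real.rpow_one k).symm
      _ ≤ y := Real.rpow_le_rpow_of_exponent_le hk1 (by norm_num)
  have e2 : k * Real.log k ≤ 20 * y := by
    have := Real.log_le_rpow_div hk0.le (show (0 : ℝ) < 1 / 20 by norm_num)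
    calc k * Real.log k ≤ k * (k ^ (1 / 20 : ℝ) / (1 / 20)) :=
          mul_le_mul_of_nonneg_left this hk0.le
      _ = 20 * (k ^ (1 : ℝ) * k ^ (1 / 20 : ℝ)) := by rw [Real.rpow_one]; ring
      _ = 20 * y := by rw [← Real.rpow_add hk0, hy]; norm_num
  have e3 : y ≤ 2 ^ (21 / 20 : ℝ) * (n : ℝ) ^ (21 / 100 : ℝ) := by
    calc y ≤ (2 * (n : ℝ) ^ (1 / 5 : ℝ)) ^ (21 / 20 : ℝ) :=
          Real.rpow_le_rpow hk0.le (binCount_le hn) (by norm_num)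
      _ = _ := by
          rw [Real.mul_rpow (by norm_num) (by positivity), ← Real.rpow_mul hn0.le]
          norm_num
  have hl0 : 0 ≤ k * Real.log k := mul_nonneg hk0.le (Real.log_nonneg hk1)
  have e4 : (n : ℝ) ^ (3 / 14 : ℝ) = (n : ℝ) ^ (21 / 100 : ℝ) * (n : ℝ) ^ (3 / 700 : ℝ) := by
    rw [← Real.rpow_add hn0]
    norm_num
  have e5 : a * k ≤ |a| * y :=
    (mul_le_mul_of_nonneg_right (le_abs_self a) hk0.le).trans
      (mul_le_mul_of_nonneg_left e1 (abs_nonneg a))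
  have e6 : b * (k * Real.log k) ≤ |b| * (20 * y) :=
    (mul_le_mul_of_nonneg_right (le_abs_self b) hl0).trans
      (mul_le_mul_of_nonneg_left e2 (abs_nonneg b))
  have e7 : (|a| + 20 * |b|) * y ≤ G * (n : ℝ) ^ (21 / 100 : ℝ) := by
    rw [hG, mul_assoc]
    exact mul_le_mul_of_nonneg_left e3 (by positivity)
  rw [e4]
  linarith

lemma exists_Icc_bounds {f : ℝ → ℝ} (hf : ContinuousOn f (Icc 0 1))
    (hpos : ∀ x ∈ Icc (0 : ℝ) 1, 0 < f x) :
    ∃ l U : ℝ, 0 < l ∧ 0 < U ∧ (∀ x ∈ Icc (0 : ℝ) 1, l ≤ f x) ∧ ∀ x ∈ Icc (0 : ℝ) 1, f x ≤ U := by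
  have hne : (Icc (0 : ℝ) 1).Nonempty := nonempty_Icc.2 zero_le_one
  obtain ⟨y, hy, hmin⟩ := isCompact_Icc.exists_isMinOn hne hf
  obtain ⟨z, hz, hmax⟩ := isCompact_Icc.exists_isMaxOn hne hf
  exact ⟨f y, f z, hpos y hy, hpos z hz, fun x hx => hmin hx, fun x hx => hmax hx⟩

/-- A polygon within `n ^ (-3/7)` has at least of the order `n ^ (3/14)` bins. -/
lemma sqrt_mul_rpow_le_of_div_sq_le {c k : ℝ} (hc : 0 < c) (hk : 0 < k) {n : ℕ} (hn : 1 ≤ n)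
    (h : c / k ^ 2 ≤ (n : ℝ) ^ (-(3 / 7) : ℝ)) : √c * (n : ℝ) ^ (3 / 14 : ℝ) ≤ k := by
  have hn0 : (0 : ℝ) < n := by exact_mod_cast hn
  rw [Real.rpow_neg hn0.le, div_le_iff₀ (by positivity), ← div_eq_inv_mul,
    le_div_iff₀ (by positivity)] at h
  refine le_of_sq_le_sq ?_ hk.le
  rw [mul_pow, Real.sq_sqrt hc.le, ← Real.rpow_natCast ((n : ℝ) ^ (3 / 14 : ℝ)),
    ← Real.rpow_mul hn0.le]
  norm_num
  exact h

lemma measureOfDensity_congr {f g : ℝ → ℝ} (h : ∀ x ∈ Icc (0 : ℝ) 1, f x = g x) :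
    measureOfDensity f = measureOfDensity g := by
  refine withDensity_congr_ae ?_
  filter_upwards [ae_restrict_mem measurableSet_Icc] with x hx
  rw [h x hx]

lemma posterior_congr {f g : ℝ → ℝ} {n : ℕ} {X : Fin n → ℝ} (h : ∀ i, f (X i) = g (X i))
    (Pr : Measure Param) (B : Set Param) : posterior Pr f X B = posterior Pr g X B := by
  simp only [posterior, h]

/-- The exponential form of the two error terms in the bound of the posterior probability. -/
lemma error_terms_le {n : ℕ} {k C δ η κ S E ρ' B₁ β₁ : ℝ} {N : ℕ} {T : ENNReal} (hkN : k = N)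
    (hk : 0 < k) (hδ : 0 < δ) (hnk : (n : ℝ) ≤ k ^ 5) (hη : 0 < η) (hκ : 0 < κ)
    (hB₁ : 0 < B₁) (hS : 0 < S)
    (hρ : B₁ * Real.exp (-β₁ * k * Real.log k) ≤ ρ')
    (hT : T ≤ ENNReal.ofReal (S * Real.exp E)) :
    ENNReal.ofReal (Real.exp (n * (2 * (C / k ^ 2) ^ 2 / δ)))
        / ENNReal.ofReal (Real.exp ((2 * C ^ 2 / δ + 1) * k))
      + T * ENNReal.ofReal (Real.exp ((2 * C ^ 2 / δ + 1) * k))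
        / (ENNReal.ofReal η * ENNReal.ofReal ρ' * ENNReal.ofReal ((κ / k ^ 4) ^ N))
    ≤ ENNReal.ofReal (Real.exp (-k)) + ENNReal.ofReal (S / (η * B₁) *
        Real.exp (E + (2 * C ^ 2 / δ + 1 - Real.log κ) * k + (β₁ + 4) * (k * Real.log k))) := by
  have hρ0 : 0 < ρ' := lt_of_lt_of_le (by positivity) hρ
  refine add_le_add ?_ ?_
  · rw [← ENNReal.ofReal_div_of_pos (Real.exp_pos _), ← Real.exp_sub]
    apply ENNReal.ofReal_le_ofReal
    apply Real.exp_le_exp.2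
    have h1 : n * (2 * (C / k ^ 2) ^ 2 / δ) ≤ k ^ 5 * (2 * (C / k ^ 2) ^ 2 / δ) :=
      mul_le_mul_of_nonneg_right hnk (by positivity)
    have h2 : k ^ 5 * (2 * (C / k ^ 2) ^ 2 / δ) = 2 * C ^ 2 / δ * k := by field_simp
    linarith
  -- As `k = N`, the small ball probability is written as an exponential so that all exponents can
  -- be collected.
  · have hpow : (κ / k ^ 4) ^ N = Real.exp (k * Real.log κ - 4 * (k * Real.log k)) := by
      rw [← Real.exp_log (show 0 < κ / k ^ 4 by positivity), ← Real.exp_nat_mul,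
        Real.log_div hκ.ne' (by positivity), Real.log_pow, hkN]
      congr 1
      push_cast
      ring
    rw [← ENNReal.ofReal_mul hη.le, ← ENNReal.ofReal_mul (by positivity)]
    calc T * ENNReal.ofReal (Real.exp ((2 * C ^ 2 / δ + 1) * k))
          / ENNReal.ofReal (η * ρ' * (κ / k ^ 4) ^ N)
        ≤ ENNReal.ofReal (S * Real.exp E) * ENNReal.ofReal (Real.exp ((2 * C ^ 2 / δ + 1) * k))
          / ENNReal.ofReal (η * (B₁ * Real.exp (-β₁ * k * Real.log k)) * (κ / k ^ 4) ^ N) := by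
          gcongr
      _ = _ := by
          rw [← ENNReal.ofReal_mul (by positivity), ← ENNReal.ofReal_div_of_pos (by positivity),
            hpow]
          congr 1
          rw [div_eq_iff (by positivity)]
          have e : ∀ p q r s t : ℝ, p + q = r + s + t →
              Real.exp p * Real.exp q = Real.exp r * (Real.exp s * Real.exp t) := by
            intro p q r s t h
            rw [← Real.exp_add, ← Real.exp_add, ← Real.exp_add, h, add_assoc]
          rw [mul_assoc S, e E ((2 * C ^ 2 / δ + 1) * k)
            (E + (2 * C ^ 2 / δ + 1 - Real.log κ) * k + (β₁ + 4) * (k * Real.log k))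
            (-β₁ * k * Real.log k) (k * Real.log κ - 4 * (k * Real.log k)) (by ring)]
          field_simp

end RandomPolygon

/-! ### The contraction lower bound -/

theorem proposition3
    (f₀ : ℝ → ℝ) (hHolder : RandomPolygon.IsHolderSmooth 3 f₀) (hF3 : RandomPolygon.MemF3 f₀)
    (hBC1 : RandomPolygon.BC1 f₀) (hBC2 : RandomPolygon.BC2 f₀)
    (hinv : ∫⁻ x in Icc (0 : ℝ) 1, (ENNReal.ofReal (f₀ x))⁻¹ < ⊤)
    (ρ : ℕ → ℝ) (hρsum : HasSum (fun m : ℕ => ρ (m + 1)) 1)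
    (B₁ B₂ β₁ β₂ : ℝ) (hB₁ : 0 < B₁) (hB₂ : 0 < B₂) (hβ₁ : 0 < β₁) (hβ₂ : 0 < β₂)
    (hρ : ∀ k : ℕ, 1 ≤ k →
      B₁ * Real.exp (-β₁ * k * Real.log k) ≤ ρ k ∧ ρ k ≤ B₂ * Real.exp (-β₂ * k * Real.log k))
    (a : ℝ → ℝ) (ha : ContinuousOn a (Icc 0 1)) (hapos : ∀ x ∈ Icc (0 : ℝ) 1, 0 < a x) :
    ∀ η : ℝ, 0 < η →
      Tendsto (fun n : ℕ =>
        Measure.pi (fun _ : Fin n => RandomPolygon.measureOfDensity f₀)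
          {X | ENNReal.ofReal η <
            RandomPolygon.posterior
              (RandomPolygon.polygonPrior ρ (RandomPolygon.measureOfDensity a)) f₀ X
              {θ | RandomPolygon.l1Dist (RandomPolygon.density θ) f₀
                ≤ (n : ℝ) ^ (-(3 / 7) : ℝ)}})
        atTop (𝓝 0) := by
  open RandomPolygon in
  intro η hη
  obtain ⟨hd1, hd2, L, -, hL⟩ := hHolder.three
  obtain ⟨M, hM0, hM⟩ := exists_taylor_bound hd1 hd2 hL
  have hc1 : ContinuousOn (der 1 f₀) (Icc 0 1) := fun x hx => (hd2 x hx).continuousWithinAt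
  have hc0 : ContinuousOn f₀ (Icc 0 1) := fun x hx => (hd1 x hx).continuousWithinAt
  have hz0 := hBC1.eq_zero hc1
  have hz1 := hBC2.eq_zero hc1
  obtain ⟨δ₀, hδ₀, hδ₀f⟩ := exists_pos_lower_bound hM0 hd1 hM hz0 hz1 hF3.nonneg hinv
  obtain ⟨δ, U, hδ0, hU0, hδ, hU⟩ :=
    exists_Icc_bounds hc0 fun x hx => hδ₀.trans_le (hδ₀f x hx)
  obtain ⟨l, A, hl0, hA0, hl, hA⟩ := exists_Icc_bounds ha hapos
  obtain ⟨u, v, c, hu, huv, hv, hc, hcg⟩ := hF3.second_away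
  obtain ⟨s, hs, hsc⟩ := exists_sign_interval hu hv hc hcg hL
  have hsub : ∀ x ∈ Ioo u v, x ∈ Icc (0 : ℝ) 1 ∧ Icc (0 : ℝ) 1 ∈ 𝓝 x := fun x hx =>
    ⟨⟨hu.trans hx.1.le, hx.2.le.trans hv⟩,
      Icc_mem_nhds (hu.trans_lt hx.1) (hx.2.trans_le hv)⟩
  obtain ⟨C₀, hC₀, hC₀l⟩ := exists_l1Dist_polygon_ge hu huv hv hc hc0
    (fun x hx => (hd1 x (hsub x hx).1).hasDerivAt (hsub x hx).2)
    (fun x hx => (hd2 x (hsub x hx).1).hasDerivAt (hsub x hx).2) hs hsc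
  obtain ⟨S, hS0, hS⟩ := exists_tail_bound hB₂ hβ₂ fun k hk => (hρ k hk).2
  -- Nothing is known about `f₀` outside `[0,1]`, not even measurability. The truncation is
  -- measurable and agrees with `f₀` at the observations almost surely.
  set f := (Icc (0 : ℝ) 1).indicator f₀ with hf
  have hff : ∀ x ∈ Icc (0 : ℝ) 1, f x = f₀ x := fun x hx => indicator_of_mem hx _
  have hfm : Measurable f := by
    rw [hf, ← piecewise_eq_indicator]
    exact hc0.measurable_piecewise continuousOn_const measurableSet_Icc
  have hfc : ContinuousOn f (Icc 0 1) := hc0.congr hff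
  have hf1 : ∫ x in Icc (0 : ℝ) 1, f x = 1 := by
    refine Eq.trans ?_ hF3.norm_one
    refine setIntegral_congr_fun measurableSet_Icc fun x hx => ?_
    rw [hff x hx, abs_of_nonneg (hF3.nonneg x hx)]
  have hprob := isProbabilityMeasure_measureOfDensity (hfc.integrableOn_Icc)
    (fun x hx => by rw [hff x hx]; exact hF3.nonneg x hx) hf1
  have hlim : Tendsto (fun n : ℕ => ENNReal.ofReal (Real.exp (-((binCount n : ℝ) + 1)))
      + ENNReal.ofReal (S / (η * B₁) *
        Real.exp (-(β₂ / 2) * (√C₀ * (n : ℝ) ^ (3 / 14 : ℝ))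
          + (2 * (U + 3 * M) ^ 2 / δ + 1 - Real.log (l * δ * Real.exp (-2) / 2))
            * ((binCount n : ℝ) + 1)
          + (β₁ + 4) * (((binCount n : ℝ) + 1) * Real.log ((binCount n : ℝ) + 1)))))
      atTop (𝓝 0) := by
    have h1 : Tendsto (fun n : ℕ => Real.exp (-((binCount n : ℝ) + 1))) atTop (𝓝 0) :=
      Real.tendsto_exp_neg_atTop_nhds_zero.comp tendsto_binCount
    have h2 := (Real.tendsto_exp_atBot.comp (tendsto_exponent
      (show 0 < β₂ / 2 * √C₀ by positivity)
      (2 * (U + 3 * M) ^ 2 / δ + 1 - Real.log (l * δ * Real.exp (-2) / 2)) (β₁ + 4))).const_mul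
      (S / (η * B₁))
    have h3 := (ENNReal.tendsto_ofReal h1).add (ENNReal.tendsto_ofReal h2)
    rw [mul_zero, ENNReal.ofReal_zero, add_zero] at h3
    refine h3.congr fun n => ?_
    simp only [Function.comp_apply]
    congr 5
    ring
  refine tendsto_of_tendsto_of_tendsto_of_le_of_le' tendsto_const_nhds hlim
    (Eventually.of_forall fun n => zero_le) ?_
  have hev1 : ∀ᶠ n in atTop, (U + 3 * M) / ((binCount n : ℝ) + 1) ^ 2 ≤ δ / 2 :=
    ((tendsto_const_nhds (x := U + 3 * M)).div_atTop
      ((tendsto_pow_atTop (α := ℝ) two_ne_zero).comp tendsto_binCount)).eventually_le_const (by positivity)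
  have hev2 : ∀ᶠ n in atTop, A / ((binCount n : ℝ) + 1) ≤ 1 :=
    ((tendsto_const_nhds (x := A)).div_atTop tendsto_binCount).eventually_le_const one_pos
  filter_upwards [hev1, hev2, eventually_ge_atTop 1] with n hn1 hn2 hn
  rw [measureOfDensity_congr fun x hx => (hff x hx).symm]
  have hρn := hρ (binCount n + 1) (by omega)
  push_cast at hρn
  -- The set `P` consists of the models forced by the approximation lower bound. The last argument
  -- exceeds the divergence bound by `k = binCount n + 1`, so the first error term is at most
  -- `exp(-k)`.
  have hkey := measure_posterior_gt_le (ρ := ρ) (a := a) (l := l) (A := A)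
    (P := {m : ℕ | √C₀ * (n : ℝ) ^ (3 / 14 : ℝ) ≤ (m : ℝ) + 1})
    (B := {θ | l1Dist (density θ) f₀ ≤ (n : ℝ) ^ (-(3 / 7) : ℝ)}) (f' := der 1 f₀) hfm hfc hf1 hδ0
    (fun x hx => by rw [hff x hx]; exact hδ x hx) (fun x hx => by rw [hff x hx]; exact hU x hx)
    hM0 (fun x hx y hy => by rw [hff x hx, hff y hy]; exact hM x hx y hy) hz0 hz1 hl0 hA0 hl hA
    (fun θ hθ => sqrt_mul_rpow_le_of_div_sq_le hC₀ (by positivity) hn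
      ((hC₀l θ.1 θ.2).trans hθ)) n (lt_of_lt_of_le (by positivity) hρn.1) hn1 hn2 hη
    ((2 * (U + 3 * M) ^ 2 / δ + 1) * ((binCount n : ℝ) + 1))
  refine (measure_mono_ae ?_).trans (hkey.trans (error_terms_le (by push_cast; rfl)
    (by positivity) hδ0 (le_binCount_pow n) hη (by positivity) hB₁ hS0 hρn.1 (hS _)))
  filter_upwards [ae_mem_Icc_pi (f := f) n] with X hX h
  change ENNReal.ofReal η < _
  rw [posterior_congr (fun i => hff _ (hX i))]
  exact h
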